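/- **Language.** Ordinary types are $B ::= \mathtt{Bool}\mid\mathtt{Int}\mid D$, with $D$ ranging over user-declared algebraic datatypes whose constructors have types $C:\{B_1\mid\varphi_1\}\to\dots\to\{B_n\mid\varphi_n\}\to D$ (each $\varphi_i$ a predicate of the $i$-th argument). Terms are E-terms $e ::= x\mid c\mid C\,e_1\dots e_n\mid g\,e_1\dots e_n$ and $t ::= e\mid \mathbf{if}\ e\ \mathbf{then}\ t\ \mathbf{else}\ t\mid \mathbf{match}\ e\ \mathbf{with}\ |_i\ C_i(x_i^1\dots x_i^{n_i})\mapsto t_i$; function terms are $\mathbf{fix}\,f.\lambda x_1\dots\lambda x_n.t$. They are evaluated by the standard call-by-value small-step semantics on configurations $\langle t,C\rangle$, $C\in\mathbb N$, in which resources are used only by $\langle\mathtt{tick}(c,t),C\rangle\hookrightarrow\langle t,C+c\rangle$; $\mathtt{tick}$ and cost-free primitive operations on values occur only in implementations of auxiliary functions. Every function $g$ has a user-defined size function $\mathtt{size}_g$ from argument tuples to $\mathbb N$. **Complexity and $O$.** For $g,h:\mathbb N\to\mathbb R$, $g\in O(h)$ means $\exists c,M\ge 0\ \forall u\ge c:\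 g(u)\le M\,h(u)$. A function $T_f:\mathbb N\to\mathbb N$ is the complexity function of $\mathbf{fix}\,f.\lambda\bar x.t$ of type $\bar x:\bar\tau\to\tau$ if the call on every input $\bar v$ of type $\bar\tau$ terminates with a value and $T_f(u)$ is, for every $u$, the supremum of the resource usages on inputs of type $\bar\tau$ with $\mathtt{size}_f(\bar v)=u$ (the supremum of the empty set is $0$). **Types.** A refinement $\varphi$ in $\{B\mid\varphi\}$ is a predicate of the program variables and of the value $v$. Function types are $x_1:\tau_1\to\dots\to x_n:\tau_n\to\tau$ with $\tau_i,\tau$ refined ordinary types. Bound expressions are $\psi=u^a\log^b u+c$ with constants $a,b,c\ge 0$. An annotation is $\alpha=([c_1,\phi_1],\dots,[c_k,\phi_k];O(\psi))$ with a finite collection of recursive-call costs, $c_i\in\mathbb N$, $\phi_i:\mathbb N\to\mathbb Z$ a function of the top-level size $u$; $O(\psi)$ abbreviates $([\,];O(\psi))$. An environment $\Gamma$ consists of base variables $x:\langle\tau,\alpha\rangle$, function signatures $g:\langle F,O(\psi)\rangle$, path conditions, and values of $\mathtt{recFun}$ and $\mathtt{args}$; its types and path conditions mention only variables bound in $\Gamma$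 (in a signature, also its parameters). $\Gamma\models P$ means that $P$ holds for all valuations $\rho$ satisfying the refinements and path conditions of $\Gamma$; $u_\rho=\mathtt{size}_{\mathtt{recFun}}(\rho(\mathtt{args}))$. **Subtyping and sharing.** $\Gamma\vdash\{B\mid\varphi\}<:\{B\mid\varphi'\}$ if $\Gamma\models\varphi\Rightarrow\varphi'$; function types are contravariant in arguments, covariant in results; $O(\psi)<:O(\psi')$ if $\Gamma\models\psi\in O(\psi')$. For annotations: $([c_i,\phi_i]_i;O(\psi))<:([c_i',\phi_i']_i;O(\psi'))$ if $c_i\le c'_i$, $\Gamma\models\phi_i(u_\rho)\le\phi_i'(u_\rho)$ and $O(\psi)<:O(\psi')$; $[c_1+c_2,\phi_1]$ may be split into, or combined from, $[c_1,\phi_1],[c_2,\phi_2]$ if $\Gamma\models\phi_1(u_\rho)=\phi_2(u_\rho)$; recursive-call costs may be added and permuted. $\alpha\curlyveedownarrow\alpha_1|\alpha_2$ if all have the same bound $\psi$ and each $[c,\phi]$ of $\alpha$ is shared into $[c_1,\phi]$ in $\alpha_1$ and $[c_2,\phi]$ in $\alpha_2$ with $c_1+c_2\le c$; $\alpha\curlyveedownarrow\alpha_1|\dots|\alpha_m$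 is the iteration of this (trivial for $m=0$, and $\alpha\curlyveedownarrow\alpha$ for $m=1$). **Typing rules.** - *E-terms* are closed under subtyping of type and annotation. If $(x:\langle\{B\mid\varphi\},\alpha\rangle)\in\Gamma$, then $\Gamma\vdash x::\langle\{B\mid\varphi\wedge v=x\},\alpha\rangle$. Constants $c$ of type $B$ have type $\langle\{B\mid v=c\},O(1)\rangle$. Function names have their signatures in $\Gamma$, up to subtyping. - *Applications.* Let $e_i::\langle\{B_i\mid\varphi_i\},\alpha_i\rangle$ be such that $B_i$ is the base type of the $i$-th parameter and all tuples $\bar y$ of values $y_i:B_i$ with $\bigwedge_i\varphi_i(y_i)$ are legal arguments of the function or constructor, under every instance of $\Gamma$. For $g:\langle\bar x:\bar\tau\to\{B\mid\varphi\},O(\psi_g)\rangle$ with $\mathtt{recFun}\ne g$ and $\alpha\curlyveedownarrow\alpha_1|\dots|\alpha_m$, where $\alpha$ has bound $\psi$, if there are $c,M\ge0$ such that $\psi_g(\mathtt{size}_g\,\bar y)\le M\psi(u_\rho)$ for all instances $\rho$ of $\Gamma$ with $u_\rho\ge c$ and all such $\bar y$, then $g\,e_1\dots e_m::\langle\{B\mid\exists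 \bar z:\bar B.\ \varphi[\bar z/\bar x]\wedge\bigwedge_i\varphi_i(z_i)\},\alpha\rangle$. If $\mathtt{recFun}=f$, if $([c_1,\phi_1],\dots,[c_k,\phi_k],\dots;O(\psi))\curlyveedownarrow\alpha_1|\dots|\alpha_m$, and if $\mathtt{size}_f\,\bar y\le\phi_k(u_\rho)$ for all instances $\rho$ and all such $\bar y$, then $f\,e_1\dots e_m$ has the analogous type with annotation $([c_1,\phi_1],\dots,[c_k+1,\phi_k],\dots;O(\psi))$. If $\alpha\curlyveedownarrow\alpha_1|\dots|\alpha_m$, then $C\,e_1\dots e_m::\langle\{D\mid\exists\bar z:\bar B.\ \bigwedge_i\varphi_i(z_i)\wedge v=C(\bar z)\},\alpha\rangle$. - *Branching.* Let $\alpha\curlyveedownarrow\alpha_1|\alpha_2$. If $\Gamma\vdash e::\langle\{\mathtt{Bool}\mid\varphi_e\},\alpha_1\rangle$, $\Gamma,\varphi_e[\mathtt{true}/v]\vdash t_1::\langle\tau,\alpha_2\rangle$ and $\Gamma,\varphi_e[\mathtt{false}/v]\vdash t_2::\langle\tau,\alpha_2\rangle$, then $\Gamma\vdash\mathbf{if}\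 e\ \mathbf{then}\ t_1\ \mathbf{else}\ t_2::\langle\tau,\alpha\rangle$. If $\Gamma\vdash e::\langle\{D\mid\varphi_e\},\alpha_1\rangle$, every $C_i$ is a constructor of $D$, and every $t_i$ has type $\langle\tau,\alpha_2\rangle$ in $\Gamma$ extended by the (new, distinct) variables $x_i^j$ at the argument types of $C_i$ and by the path condition $\varphi_e[C_i(\bar x_i)/v]$, then the $\mathbf{match}$ term has type $\langle\tau,\alpha\rangle$ in $\Gamma$. - *Functions.* Let $f,x_1,\dots,x_n$ be distinct and new for $\Gamma$, and let $F=x_1:\tau_1\to\dots\to x_n:\tau_n\to\tau$ be a type whose free variables, apart from the $x_i$, are bound in $\Gamma$. If $\Gamma[\mathtt{recFun}\leftarrow f][\mathtt{args}\leftarrow x_1\dots x_n];x_1:\langle\tau_1,O(1)\rangle;\dots;x_n:\langle\tau_n,O(1)\rangle;f:\langle F,O(\psi)\rangle\vdash t::\langle\tau,A\rangle$, then $\Gamma\vdash\mathbf{fix}\,f.\lambda x_1\dots\lambda x_n.t::\langle F,O(\psi)\rangle$, where $(A,\psi)$ is one of $(([1,\lfloor u/d\rfloor];O(1)),\ \log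 u)$ and $(([d,\lfloor u/d\rfloor];O(u)),\ u\log u)$ with $d\ge2$ an integer; $(([1,\lceil u/2\rceil],[1,\lfloor u/2\rfloor];O(u)),\ u\log u)$; $(([1,u-d];O(1)),\ u)$ and $(([1,u-d];O(u)),\ u^2)$ with $d\ge1$ an integer. **Theorem (Soundness of type checking).** Let $\Gamma$ be an environment and let $\Gamma\vdash\mathbf{fix}\,f.\lambda x_1\dots\lambda x_n.t::\langle F,O(\psi)\rangle$ be derivable. Fix any values of the base variables of $\Gamma$ that satisfy its refinements and path conditions, and, for every function $g$ of $\Gamma$, any closed function term implementing $g$ that meets the signatures $\langle F_g,O(\psi_g)\rangle$ of $g$ in $\Gamma$, i.e. its results on inputs of the argument types of $F_g$ have the result type of $F_g$, and it has a complexity function $T_g\in O(\psi_g)$. If $T_f$ is the complexity function of $\mathbf{fix}\,f.\lambda x_1\dots\lambda x_n.t$ (with these values and implementations substituted), then $T_f\in O(\psi)$. -/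

import Mathlib

namespace SynPlexity

/-! Names and values -/

/-- Names of base variables and (in a separate name space) of functions. -/
abbrev Var := ℕ

/-- Names of datatype constructors. -/
abbrev Con := ℕ

/-- Names of user-defined algebraic datatypes. -/
abbrev DName := ℕ

/-- Ordinary types `B ::= Bool | Int | D`. -/
inductive Base
  | int
  | bool
  | data (D : DName)

/-- First-order values: integers, Booleans, and constructors applied to values. -/
inductive Val
  | int (z : ℤ)
  | bool (b : Bool)
  | con (C : Con) (n : ℕ) (ws : Fin n → Val)

/-- Declarations of the user-defined datatypes: every constructor `C` has a type
`{B₁ | φ₁} → … → {Bₙ | φₙ} → D`. -/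
structure DataSig where
  arity : Con → ℕ
  argBase : (C : Con) → Fin (arity C) → Base
  argRef : (C : Con) → Fin (arity C) → Val → Prop
  res : Con → DName

/-- `𝒟.HasBase B w`: the value `w` inhabits the ordinary type `B`. -/
inductive DataSig.HasBase (𝒟 : DataSig) : Base → Val → Prop
  | int (z : ℤ) : 𝒟.HasBase .int (.int z)
  | bool (b : Bool) : 𝒟.HasBase .bool (.bool b)
  | con (C : Con) (ws : Fin (𝒟.arity C) → Val)
      (hbase : ∀ i, 𝒟.HasBase (𝒟.argBase C i) (ws i))
      (href : ∀ i, 𝒟.argRef C i (ws i)) :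
      𝒟.HasBase (.data (𝒟.res C)) (.con C (𝒟.arity C) ws)

/-! Terms and the concrete-cost small-step semantics -/

/-- Terms.  The surface language consists of the forms `var`, `const`, `con`, `app` with a
function name `fvar g` as head, `ite`, `mtch` and an outermost `fix`; only these are typable.
`tick` and the primitive operators `prim` (zero-cost operations on values, such as `+` or `=`)
occur in implementations of auxiliary functions only. -/
inductive Tm
  | var (x : Var)
  | fvar (g : Var)
  | const (v : Val)
  | con (C : Con) (n : ℕ) (es : Fin n → Tm)
  | prim (n : ℕ) (o : (Fin n → Val) → Val) (es : Fin n → Tm)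
  | app (h : Tm) (n : ℕ) (es : Fin n → Tm)
  | ite (e t₁ t₂ : Tm)
  | mtch (e : Tm) (m : ℕ) (C : Fin m → Con) (k : Fin m → ℕ) (xs : ∀ i, Fin (k i) → Var)
      (t : Fin m → Tm)
  | fix (f : Var) (n : ℕ) (xs : Fin n → Var) (t : Tm)
  | tick (c : ℕ) (t : Tm)

/-- Simultaneous substitution of values for base variables (`σ`) and of closed terms for function
names (`θ`).  Names bound by `fix` and `mtch` are removed from the substitution in their scope. -/
noncomputable def Tm.subst : Tm → (Var → Option Val) → (Var → Option Tm) → Tm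
  | .var x, σ, _ => (σ x).elim (.var x) .const
  | .fvar g, _, θ => (θ g).getD (.fvar g)
  | .const v, _, _ => .const v
  | .con C n es, σ, θ => .con C n fun i => (es i).subst σ θ
  | .prim n o es, σ, θ => .prim n o fun i => (es i).subst σ θ
  | .app h n es, σ, θ => .app (h.subst σ θ) n fun i => (es i).subst σ θ
  | .ite e t₁ t₂, σ, θ => .ite (e.subst σ θ) (t₁.subst σ θ) (t₂.subst σ θ)
  | .mtch e m C k xs t, σ, θ =>
      .mtch (e.subst σ θ) m C k xs fun i =>
        (t i).subst (Function.extend (xs i) (fun _ => none) σ) θ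
  | .fix f n xs t, σ, θ =>
      .fix f n xs (t.subst (Function.extend xs (fun _ => none) σ) (Function.update θ f none))
  | .tick c t, σ, θ => .tick c (t.subst σ θ)

/-- A term is closed if no substitution changes it. -/
def Tm.Closed (t : Tm) : Prop := ∀ σ θ, t.subst σ θ = t

/-- The list of arguments `es` consists of values up to position `i` (exclusive). -/
def ValuesBefore {n : ℕ} (es : Fin n → Tm) (i : Fin n) : Prop :=
  ∀ j, j < i → ∃ w, es j = .const w

/-- One step `⟨t, c⟩ ↪ ⟨t', c'⟩` of the concrete-cost semantics; arguments are evaluated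
from left to right, before the call. -/
inductive Step : Tm × ℕ → Tm × ℕ → Prop
  | tick (c : ℕ) (t : Tm) (C : ℕ) : Step (.tick c t, C) (t, C + c)
  | app (f : Var) (n : ℕ) (xs : Fin n → Var) (t : Tm) (es : Fin n → Tm) (ws : Fin n → Val) (C : ℕ)
      (hes : ∀ i, es i = .const (ws i)) :
      Step (.app (.fix f n xs t) n es, C)
        (t.subst (Function.extend xs (fun i => some (ws i)) fun _ => none)
          (Function.update (fun _ => none) f (some (.fix f n xs t))), C)
  | appArg (f : Var) (m : ℕ) (xs : Fin m → Var) (t : Tm) (n : ℕ) (es : Fin n → Tm) (i : Fin n)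
      (e' : Tm) (C Δ : ℕ) (hval : ValuesBefore es i) (hstep : Step (es i, 0) (e', Δ)) :
      Step (.app (.fix f m xs t) n es, C)
        (.app (.fix f m xs t) n (Function.update es i e'), C + Δ)
  | con (K : Con) (n : ℕ) (es : Fin n → Tm) (ws : Fin n → Val) (C : ℕ)
      (hes : ∀ i, es i = .const (ws i)) :
      Step (.con K n es, C) (.const (.con K n ws), C)
  | conArg (K : Con) (n : ℕ) (es : Fin n → Tm) (i : Fin n) (e' : Tm) (C Δ : ℕ)
      (hval : ValuesBefore es i) (hstep : Step (es i, 0) (e', Δ)) :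
      Step (.con K n es, C) (.con K n (Function.update es i e'), C + Δ)
  | prim (n : ℕ) (o : (Fin n → Val) → Val) (es : Fin n → Tm) (ws : Fin n → Val) (C : ℕ)
      (hes : ∀ i, es i = .const (ws i)) :
      Step (.prim n o es, C) (.const (o ws), C)
  | primArg (n : ℕ) (o : (Fin n → Val) → Val) (es : Fin n → Tm) (i : Fin n) (e' : Tm) (C Δ : ℕ)
      (hval : ValuesBefore es i) (hstep : Step (es i, 0) (e', Δ)) :
      Step (.prim n o es, C) (.prim n o (Function.update es i e'), C + Δ)
  | condTrue (t₁ t₂ : Tm) (C : ℕ) : Step (.ite (.const (.bool true)) t₁ t₂, C) (t₁, C)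
  | condFalse (t₁ t₂ : Tm) (C : ℕ) : Step (.ite (.const (.bool false)) t₁ t₂, C) (t₂, C)
  | condGuard (e e' t₁ t₂ : Tm) (C Δ : ℕ) (hstep : Step (e, 0) (e', Δ)) :
      Step (.ite e t₁ t₂, C) (.ite e' t₁ t₂, C + Δ)
  | mtch (v : Val) (m : ℕ) (K : Fin m → Con) (k : Fin m → ℕ) (xs : ∀ i, Fin (k i) → Var)
      (t : Fin m → Tm) (i : Fin m) (ws : Fin (k i) → Val) (C : ℕ)
      (hv : v = .con (K i) (k i) ws) :
      Step (.mtch (.const v) m K k xs t, C)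
        ((t i).subst (Function.extend (xs i) (fun j => some (ws j)) fun _ => none)
          (fun _ => none), C)
  | mtchScrutinee (e e' : Tm) (m : ℕ) (K : Fin m → Con) (k : Fin m → ℕ)
      (xs : ∀ i, Fin (k i) → Var) (t : Fin m → Tm) (C Δ : ℕ) (hstep : Step (e, 0) (e', Δ)) :
      Step (.mtch e m K k xs t, C) (.mtch e' m K k xs t, C + Δ)

/-- `⟨t, 0⟩ ↪* ⟨v, C⟩`: the term `t` evaluates to the value `v` with resource usage `C`. -/
def Evaluates (t : Tm) (v : Val) (C : ℕ) : Prop :=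
  Relation.ReflTransGen Step (t, 0) (.const v, C)

/-! Types, bounds, annotations, environments -/

/-- Valuations of the base variables (total, for convenience). -/
abbrev Store := Var → Val

/-- A refined ordinary type `{B | φ}`.  The refinement `φ` is a predicate of the valuation of the
program variables and of the value of the reserved variable `v`. -/
structure RTy where
  base : Base
  ref : Store → Val → Prop

/-- Membership of the value `w` in `{B | φ}` under the valuation `ρ`. -/
def RTy.Mem (𝒟 : DataSig) (τ : RTy) (ρ : Store) (w : Val) : Prop :=
  𝒟.HasBase τ.base w ∧ τ.ref ρ w

/-- All free variables of the refinement lie in `S`. -/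
def RTy.Scoped (τ : RTy) (S : Set Var) : Prop :=
  ∀ ρ ρ' : Store, Set.EqOn ρ ρ' S → ∀ w, τ.ref ρ w ↔ τ.ref ρ' w

/-- A first-order function type `x₁ : τ₁ → … → xₙ : τₙ → τ`, where the `xᵢ` (`params`) may occur in
the refinements. -/
structure FunTy (n : ℕ) where
  params : Fin n → Var
  dom : Fin n → RTy
  cod : RTy

/-- The valuation `ρ` with the parameters of `F` set to `ws`. -/
noncomputable def FunTy.set {n : ℕ} (F : FunTy n) (ρ : Store) (ws : Fin n → Val) : Store :=
  Function.extend F.params ws ρ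

/-- The tuple `ws` is an input of type `τ₁, …, τₙ`. -/
def FunTy.Inputs {n : ℕ} (𝒟 : DataSig) (F : FunTy n) (ρ : Store) (ws : Fin n → Val) : Prop :=
  ∀ i, (F.dom i).Mem 𝒟 (F.set ρ ws) (ws i)

/-- All free variables of the function type lie in `S`. -/
def FunTy.Scoped {n : ℕ} (F : FunTy n) (S : Set Var) : Prop :=
  (∀ i, (F.dom i).Scoped (S ∪ Set.range F.params)) ∧ F.cod.Scoped (S ∪ Set.range F.params)

/-- Bound expressions `ψ = u ^ a * log ^ b u + c`. -/
structure Bound where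
  a : NNReal
  b : NNReal
  c : NNReal

noncomputable def Bound.eval (ψ : Bound) (u : ℕ) : ℝ :=
  (u : ℝ) ^ (ψ.a : ℝ) * Real.log u ^ (ψ.b : ℝ) + ψ.c

/-- `g ∈ O(f)`. -/
def BigO (g f : ℕ → ℝ) : Prop := ∃ (c : ℕ) (M : ℝ), 0 ≤ M ∧ ∀ x, c ≤ x → g x ≤ M * f x

/-- The bound expression `1`. -/
def Bound.one : Bound := ⟨0, 0, 0⟩

/-- The bound expression `u`. -/
def Bound.lin : Bound := ⟨1, 0, 0⟩

/-- The bound expression `u ^ 2`. -/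
def Bound.quad : Bound := ⟨2, 0, 0⟩

/-- The bound expression `log u`. -/
def Bound.logarithmic : Bound := ⟨0, 1, 0⟩

/-- The bound expression `u * log u`. -/
def Bound.linLog : Bound := ⟨1, 1, 0⟩

/-- Recurrence annotations `([c₁, φ₁], …, [cₙ, φₙ]; O(ψ))`; a size expression `φ` is given by its
value as a function of the size `u` of the top-level problem. -/
structure Ann where
  costs : List (ℕ × (ℕ → ℤ))
  bound : Bound

/-- The annotation `O(1)`. -/
def Ann.one : Ann := ⟨[], .one⟩

/-- Entries of an environment: a base variable with an annotated type, a function with its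
signature `⟨F, O(ψ)⟩`, or a path condition. -/
inductive Entry
  | var (x : Var) (τ : RTy) (α : Ann)
  | fn (g : Var) (n : ℕ) (F : FunTy n) (ψ : Bound)
  | path (p : Store → Prop)

/-- Environments, with the assignments for `recFun` and `args`. -/
structure Env where
  entries : List Entry
  recFun : Option Var
  args : Σ n : ℕ, (Fin n → Var)

/-- The base variables bound in `Γ`. -/
def Env.vars (Γ : Env) : Set Var := {x | ∃ τ α, Entry.var x τ α ∈ Γ.entries}

/-- The functions bound in `Γ`. -/
def Env.funs (Γ : Env) : Set Var := {g | ∃ n F ψ, Entry.fn g n F ψ ∈ Γ.entries}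

/-- `Γ` is well scoped: only variables bound in `Γ` (and the parameters of a signature) occur in
its types and path conditions. -/
def Env.Scoped (Γ : Env) : Prop :=
  (∀ x τ α, Entry.var x τ α ∈ Γ.entries → τ.Scoped Γ.vars) ∧
  (∀ g n (F : FunTy n) ψ, Entry.fn g n F ψ ∈ Γ.entries → F.Scoped Γ.vars) ∧
  (∀ p, Entry.path p ∈ Γ.entries →
    ∀ ρ ρ' : Store, Set.EqOn ρ ρ' Γ.vars → (p ρ ↔ p ρ'))

/-- The valuation `ρ` is an instance of `Γ`: it satisfies the refinements of all base variables and
all path conditions of `Γ`.  A validity claim `Γ ⊨ P` is `∀ ρ, Γ.Sat 𝒟 ρ → P ρ`. -/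
def Env.Sat (𝒟 : DataSig) (Γ : Env) (ρ : Store) : Prop :=
  (∀ x τ α, Entry.var x τ α ∈ Γ.entries → τ.Mem 𝒟 ρ (ρ x)) ∧
  (∀ p, Entry.path p ∈ Γ.entries → p ρ)

/-- Extension of an environment by a path condition. -/
def Env.assume (Γ : Env) (p : Store → Prop) : Env :=
  { Γ with entries := .path p :: Γ.entries }

/-- The user-specified size functions, one for every function name (and number of arguments). -/
abbrev SizeFun := Var → (n : ℕ) → (Fin n → Val) → ℕ

/-- The size `u = size Γ(args)` of the top-level problem under the valuation `ρ`. -/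
def Env.topSize (size : SizeFun) (Γ : Env) (ρ : Store) : ℕ :=
  match Γ.recFun with
  | some f => size f Γ.args.1 fun i => ρ (Γ.args.2 i)
  | none => 0

/-! Subtyping and cost sharing -/

/-- `Γ ⊢ {B | φ} <: {B' | φ'}`. -/
def RTy.Sub (𝒟 : DataSig) (Γ : Env) (τ τ' : RTy) : Prop :=
  τ.base = τ'.base ∧ ∀ ρ, Γ.Sat 𝒟 ρ → ∀ w, τ.Mem 𝒟 ρ w → τ'.ref ρ w

/-- Subtyping of function types: contravariant in the arguments, covariant in the result. -/
def FunTy.Sub {n : ℕ} (𝒟 : DataSig) (Γ : Env) (F F' : FunTy n) : Prop :=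
  (∀ i, (F'.dom i).base = (F.dom i).base) ∧ F.cod.base = F'.cod.base ∧
  ∀ ρ, Γ.Sat 𝒟 ρ → ∀ ws, F'.Inputs 𝒟 ρ ws → F.Inputs 𝒟 ρ ws ∧
    ∀ w, F.cod.Mem 𝒟 (F.set ρ ws) w → F'.cod.ref (F'.set ρ ws) w

/-- `Γ ⊢ O(ψ) <: O(ψ')`. -/
def Bound.Sub (𝒟 : DataSig) (Γ : Env) (ψ ψ' : Bound) : Prop :=
  ∀ ρ, Γ.Sat 𝒟 ρ → BigO ψ.eval ψ'.eval

/-- `Γ ⊢ α <: α'` for recurrence annotations. -/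
inductive Ann.Sub (𝒟 : DataSig) (size : SizeFun) (Γ : Env) : Ann → Ann → Prop
  | mono (l l' : List (ℕ × (ℕ → ℤ))) (ψ ψ' : Bound)
      (hcost : List.Forall₂ (fun p p' => p.1 ≤ p'.1 ∧
        ∀ ρ, Γ.Sat 𝒟 ρ → p.2 (Γ.topSize size ρ) ≤ p'.2 (Γ.topSize size ρ)) l l')
      (hbound : ψ.Sub 𝒟 Γ ψ') : Ann.Sub 𝒟 size Γ ⟨l, ψ⟩ ⟨l', ψ'⟩
  | split (c₁ c₂ : ℕ) (φ₁ φ₂ : ℕ → ℤ) (l : List (ℕ × (ℕ → ℤ))) (ψ : Bound)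
      (hφ : ∀ ρ, Γ.Sat 𝒟 ρ → φ₁ (Γ.topSize size ρ) = φ₂ (Γ.topSize size ρ)) :
      Ann.Sub 𝒟 size Γ ⟨(c₁ + c₂, φ₁) :: l, ψ⟩ ⟨(c₁, φ₁) :: (c₂, φ₂) :: l, ψ⟩
  | combine (c₁ c₂ : ℕ) (φ₁ φ₂ : ℕ → ℤ) (l : List (ℕ × (ℕ → ℤ))) (ψ : Bound)
      (hφ : ∀ ρ, Γ.Sat 𝒟 ρ → φ₁ (Γ.topSize size ρ) = φ₂ (Γ.topSize size ρ)) :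
      Ann.Sub 𝒟 size Γ ⟨(c₁, φ₁) :: (c₂, φ₂) :: l, ψ⟩ ⟨(c₁ + c₂, φ₁) :: l, ψ⟩
  | add (c : ℕ) (φ : ℕ → ℤ) (l : List (ℕ × (ℕ → ℤ))) (ψ : Bound) :
      Ann.Sub 𝒟 size Γ ⟨l, ψ⟩ ⟨(c, φ) :: l, ψ⟩
  | perm (l l' : List (ℕ × (ℕ → ℤ))) (ψ : Bound) (hperm : l.Perm l') :
      Ann.Sub 𝒟 size Γ ⟨l, ψ⟩ ⟨l', ψ⟩

/-- Sharing of lists of recursive-call costs: each `[c, φ]` is shared into `[c₁, φ]` and `[c₂, φ]`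
with `c₁ + c₂ ≤ c`. -/
inductive CostShare : List (ℕ × (ℕ → ℤ)) → List (ℕ × (ℕ → ℤ)) → List (ℕ × (ℕ → ℤ)) → Prop
  | nil : CostShare [] [] []
  | cons (c c₁ c₂ : ℕ) (φ : ℕ → ℤ) (l l₁ l₂ : List (ℕ × (ℕ → ℤ))) (hc : c₁ + c₂ ≤ c)
      (htail : CostShare l l₁ l₂) : CostShare ((c, φ) :: l) ((c₁, φ) :: l₁) ((c₂, φ) :: l₂)

/-- `α ⋎ α₁ | α₂`. -/
def Ann.Share (α α₁ α₂ : Ann) : Prop :=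
  α₁.bound = α.bound ∧ α₂.bound = α.bound ∧ CostShare α.costs α₁.costs α₂.costs

/-- `α ⋎ α₁ | … | αₘ`. -/
inductive Ann.ShareMany : Ann → List Ann → Prop
  | nil (α : Ann) : Ann.ShareMany α []
  | refl (α : Ann) : Ann.ShareMany α [α]
  | cons (α α₁ α' : Ann) (αs : List Ann) (hshare : α.Share α₁ α') (htail : Ann.ShareMany α' αs) :
      Ann.ShareMany α (α₁ :: αs)

/-! Typing -/

/-- `Γ ⊢ g :: ⟨F, O(ψ)⟩` for a function name `g`: lookup and subtyping. -/
inductive FunNameTy (𝒟 : DataSig) (Γ : Env) (g : Var) (n : ℕ) : FunTy n → Bound → Prop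
  | var (F : FunTy n) (ψ : Bound) (hmem : Entry.fn g n F ψ ∈ Γ.entries) : FunNameTy 𝒟 Γ g n F ψ
  | sub (F F' : FunTy n) (ψ ψ' : Bound) (hty : FunNameTy 𝒟 Γ g n F ψ) (hF : F.Sub 𝒟 Γ F')
      (hψ : ψ.Sub 𝒟 Γ ψ') : FunNameTy 𝒟 Γ g n F' ψ'

/-- The type of an application of a function of type `F` to arguments of types `τs`:
`{B | [z/x]φ ∧ ⋀ᵢ [zᵢ/v]φᵢ}` with fresh `zᵢ`. -/
def appTy (𝒟 : DataSig) {n : ℕ} (F : FunTy n) (τs : Fin n → RTy) : RTy where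
  base := F.cod.base
  ref ρ w := ∃ zs : Fin n → Val, (∀ i, (τs i).Mem 𝒟 ρ (zs i)) ∧ F.cod.ref (F.set ρ zs) w

/-- The arguments of types `τs` are legal arguments for a function of type `F`. -/
def ArgsOK (𝒟 : DataSig) (Γ : Env) {n : ℕ} (τs : Fin n → RTy) (F : FunTy n) : Prop :=
  (∀ i, (τs i).base = (F.dom i).base) ∧
  ∀ ρ, Γ.Sat 𝒟 ρ → ∀ ys : Fin n → Val, (∀ i, (τs i).Mem 𝒟 ρ (ys i)) → F.Inputs 𝒟 ρ ys

/-- `Γ ⊢ e :: ⟨τ, α⟩` for E-terms. -/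
inductive ETermTy (𝒟 : DataSig) (size : SizeFun) (Γ : Env) : Tm → RTy → Ann → Prop
  | sub (e : Tm) (τ τ' : RTy) (α α' : Ann) (hty : ETermTy 𝒟 size Γ e τ α)
      (hτ : τ.Sub 𝒟 Γ τ') (hα : Ann.Sub 𝒟 size Γ α α') : ETermTy 𝒟 size Γ e τ' α'
  | var (x : Var) (τ : RTy) (α : Ann) (hmem : Entry.var x τ α ∈ Γ.entries) :
      ETermTy 𝒟 size Γ (.var x) ⟨τ.base, fun ρ w => τ.ref ρ w ∧ w = ρ x⟩ α
  | const (v : Val) (B : Base) (hv : 𝒟.HasBase B v) :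
      ETermTy 𝒟 size Γ (.const v) ⟨B, fun _ w => w = v⟩ .one
  | con (C : Con) (es : Fin (𝒟.arity C) → Tm) (τs : Fin (𝒟.arity C) → RTy)
      (αs : Fin (𝒟.arity C) → Ann) (α : Ann)
      (hshare : α.ShareMany (List.ofFn αs))
      (hes : ∀ i, ETermTy 𝒟 size Γ (es i) (τs i) (αs i))
      (harg : ∀ i, (τs i).Sub 𝒟 Γ ⟨𝒟.argBase C i, fun _ w => 𝒟.argRef C i w⟩) :
      ETermTy 𝒟 size Γ (.con C (𝒟.arity C) es)
        ⟨.data (𝒟.res C), fun ρ w => ∃ zs : Fin (𝒟.arity C) → Val,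
          (∀ i, (τs i).Mem 𝒟 ρ (zs i)) ∧ w = .con C (𝒟.arity C) zs⟩ α
  | app (g : Var) (m : ℕ) (F : FunTy m) (ψg : Bound) (es : Fin m → Tm) (τs : Fin m → RTy)
      (αs : Fin m → Ann) (α : Ann)
      (hg : FunNameTy 𝒟 Γ g m F ψg) (hrec : Γ.recFun ≠ some g)
      (hshare : α.ShareMany (List.ofFn αs))
      (hes : ∀ i, ETermTy 𝒟 size Γ (es i) (τs i) (αs i))
      (harg : ArgsOK 𝒟 Γ τs F)
      (hcost : ∃ (c : ℕ) (M : ℝ), 0 ≤ M ∧ ∀ ρ, Γ.Sat 𝒟 ρ → ∀ ys : Fin m → Val,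
        (∀ i, (τs i).Mem 𝒟 ρ (ys i)) → c ≤ Γ.topSize size ρ →
          ψg.eval (size g m ys) ≤ M * α.bound.eval (Γ.topSize size ρ)) :
      ETermTy 𝒟 size Γ (.app (.fvar g) m es) (appTy 𝒟 F τs) α
  | recApp (f : Var) (m : ℕ) (F : FunTy m) (ψf : Bound) (es : Fin m → Tm) (τs : Fin m → RTy)
      (αs : Fin m → Ann) (l₁ l₂ : List (ℕ × (ℕ → ℤ))) (c : ℕ) (φ : ℕ → ℤ) (ψ : Bound)
      (hf : FunNameTy 𝒟 Γ f m F ψf) (hrec : Γ.recFun = some f)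
      (hshare : Ann.ShareMany ⟨l₁ ++ (c, φ) :: l₂, ψ⟩ (List.ofFn αs))
      (hes : ∀ i, ETermTy 𝒟 size Γ (es i) (τs i) (αs i))
      (harg : ArgsOK 𝒟 Γ τs F)
      (hsize : ∀ ρ, Γ.Sat 𝒟 ρ → ∀ ys : Fin m → Val, (∀ i, (τs i).Mem 𝒟 ρ (ys i)) →
        (size f m ys : ℤ) ≤ φ (Γ.topSize size ρ)) :
      ETermTy 𝒟 size Γ (.app (.fvar f) m es) (appTy 𝒟 F τs) ⟨l₁ ++ (c + 1, φ) :: l₂, ψ⟩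

/-- The environment of the branch `C (x₁ … xₙ) ↦ t` of a match on a term of type `τ`: the `xᵢ` are
bound at the argument types of `C`, and the value `C (x₁ … xₙ)` satisfies the refinement of `τ`. -/
def Env.branch (𝒟 : DataSig) (Γ : Env) (τ : RTy) (C : Con) (xs : Fin (𝒟.arity C) → Var) : Env :=
  { Γ with
    entries := .path (fun ρ => τ.ref ρ (.con C (𝒟.arity C) fun j => ρ (xs j))) ::
      (List.ofFn fun j => .var (xs j) ⟨𝒟.argBase C j, fun _ w => 𝒟.argRef C j w⟩ .one) ++
        Γ.entries }

/-- `Γ ⊢ t :: ⟨τ, α⟩` for E-terms and branching terms. -/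
inductive TermTy (𝒟 : DataSig) (size : SizeFun) : Env → Tm → RTy → Ann → Prop
  | eterm (Γ : Env) (e : Tm) (τ : RTy) (α : Ann) (hty : ETermTy 𝒟 size Γ e τ α) :
      TermTy 𝒟 size Γ e τ α
  | ite (Γ : Env) (e t₁ t₂ : Tm) (φ : Store → Val → Prop) (τ : RTy) (α α₁ α₂ : Ann)
      (hshare : α.Share α₁ α₂) (he : ETermTy 𝒟 size Γ e ⟨.bool, φ⟩ α₁)
      (h₁ : TermTy 𝒟 size (Γ.assume fun ρ => φ ρ (.bool true)) t₁ τ α₂)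
      (h₂ : TermTy 𝒟 size (Γ.assume fun ρ => φ ρ (.bool false)) t₂ τ α₂) :
      TermTy 𝒟 size Γ (.ite e t₁ t₂) τ α
  | mtch (Γ : Env) (e : Tm) (m : ℕ) (C : Fin m → Con) (xs : ∀ i, Fin (𝒟.arity (C i)) → Var)
      (t : Fin m → Tm) (D : DName) (τs τ : RTy) (α α₁ α₂ : Ann)
      (hshare : α.Share α₁ α₂) (he : ETermTy 𝒟 size Γ e τs α₁) (hD : τs.base = .data D)
      (hres : ∀ i, 𝒟.res (C i) = D)
      (hinj : ∀ i, Function.Injective (xs i)) (hfresh : ∀ i j, xs i j ∉ Γ.vars)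
      (ht : ∀ i, TermTy 𝒟 size (Γ.branch 𝒟 τs (C i) (xs i)) (t i) τ α₂) :
      TermTy 𝒟 size Γ (.mtch e m C (fun i => 𝒟.arity (C i)) xs t) τ α

/-- The pairs (annotation `A` of the body, bound `B` of the function) with which the typing rule for
function terms can be instantiated. -/
inductive Pattern : Ann → Bound → Prop
  | masterLog (d : ℕ) (hd : 2 ≤ d) : Pattern ⟨[(1, fun u => ⌊(u : ℚ) / d⌋)], .one⟩ .logarithmic
  | masterLinLog (d : ℕ) (hd : 2 ≤ d) : Pattern ⟨[(d, fun u => ⌊(u : ℚ) / d⌋)], .lin⟩ .linLog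
  | akraBazzi :
      Pattern ⟨[(1, fun u => ⌈(u : ℚ) / 2⌉), (1, fun u => ⌊(u : ℚ) / 2⌋)], .lin⟩ .linLog
  | cFiniteLin (d : ℕ) (hd : 1 ≤ d) : Pattern ⟨[(1, fun u => (u : ℤ) - d)], .one⟩ .lin
  | cFiniteQuad (d : ℕ) (hd : 1 ≤ d) : Pattern ⟨[(1, fun u => (u : ℤ) - d)], .lin⟩ .quad

/-- The environment in which the body of `fix f. λ x₁ … xₙ. t` is checked against `⟨F, O(B)⟩`. -/
def Env.enter (Γ : Env) (f : Var) {n : ℕ} (F : FunTy n) (B : Bound) : Env where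
  entries := .fn f n F B :: (List.ofFn fun i => .var (F.params i) (F.dom i) .one) ++ Γ.entries
  recFun := some f
  args := ⟨n, F.params⟩

/-- `Γ ⊢ fix f. λ x₁ … xₙ. t :: ⟨F, O(B)⟩`.  The bound names are distinct and new for `Γ`, and the
declared type is well scoped. -/
inductive FunTermTy (𝒟 : DataSig) (size : SizeFun) (Γ : Env) {n : ℕ} :
    Tm → FunTy n → Bound → Prop
  | abs (f : Var) (t : Tm) (F : FunTy n) (A : Ann) (B : Bound)
      (hpat : Pattern A B)
      (hinj : Function.Injective F.params) (hfresh : ∀ i, F.params i ∉ Γ.vars)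
      (hf : f ∉ Γ.funs) (hscope : F.Scoped Γ.vars)
      (ht : TermTy 𝒟 size (Γ.enter f F B) t F.cod A) :
      FunTermTy 𝒟 size Γ (.fix f n F.params t) F B

/-! Complexity -/

/-- `T` is the complexity function of the closed function term `fn` of type `F` with size function
`sz`: every evaluation on an input terminates with a value, and `T u` is the supremum of the
resource usages on inputs of size `u`. -/
def IsComplexity (𝒟 : DataSig) {n : ℕ} (sz : (Fin n → Val) → ℕ) (F : FunTy n) (ρ : Store)
    (fn : Tm) (T : ℕ → ℕ) : Prop :=
  (∀ ws, F.Inputs 𝒟 ρ ws → ∃ v C, Evaluates (.app fn n fun i => .const (ws i)) v C) ∧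
  ∀ u, IsLUB {C | ∃ ws, F.Inputs 𝒟 ρ ws ∧ sz ws = u ∧
    ∃ v, Evaluates (.app fn n fun i => .const (ws i)) v C} (T u)

/-- The function term `fn` implements the signature `⟨F, O(ψ)⟩`. -/
def Implements (𝒟 : DataSig) {n : ℕ} (sz : (Fin n → Val) → ℕ) (F : FunTy n) (ψ : Bound)
    (ρ : Store) (fn : Tm) : Prop :=
  (∃ f xs t, fn = .fix f n xs t) ∧
  (∀ ws, F.Inputs 𝒟 ρ ws → ∀ v C, Evaluates (.app fn n fun i => .const (ws i)) v C →
    F.cod.Mem 𝒟 (F.set ρ ws) v) ∧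
  ∃ T : ℕ → ℕ, IsComplexity 𝒟 sz F ρ fn T ∧ BigO (fun u => T u) ψ.eval

/-- `(ρ, θ)` interprets the environment `Γ`: `ρ` gives values of the base variables that satisfy the
refinements and path conditions, and `θ` gives closed implementations of the functions that meet
their signatures. -/
def Env.Interp (𝒟 : DataSig) (size : SizeFun) (Γ : Env) (ρ : Store) (θ : Var → Tm) : Prop :=
  Γ.Sat 𝒟 ρ ∧ (∀ g, (θ g).Closed) ∧
  ∀ g n (F : FunTy n) ψ, Entry.fn g n F ψ ∈ Γ.entries → Implements 𝒟 (size g n) F ψ ρ (θ g)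

/-- The closed term obtained from `t` by putting in the values and implementations of `(ρ, θ)`. -/
noncomputable def Tm.close (t : Tm) (ρ : Store) (θ : Var → Tm) : Tm :=
  t.subst (fun x => some (ρ x)) fun g => some (θ g)

end SynPlexity

open SynPlexity

/-!
The cost of a call is compared with a recurrence, and the recurrence is solved.

*Semantics.* `Run k t v C` is evaluation with a step count; its inversion lemmas split an evaluation
of an application, conditional or match into evaluations of its parts.  As substitutions compose
(`Tm.subst_subst`), a call of the closed function is an evaluation of the body, closed with the
arguments and with the closed function itself in the place of `f`.

*Type soundness* (`ETermTy.sound`, `TermTy.sound`). If the functions meet their signatures for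
evaluations of at most `N` steps, then so do the typed terms.  Since the body takes fewer steps than
the call, induction on `N` shows that the recursive function meets its type
(`Env.enter_meetsTypes`).  Termination plays no role here.  The values of subterms enter the path
conditions, which have to survive the binding of further variables; `Env.StrongSat` ensures this.

*Cost soundness* (`ETermTy.costBounded`, `TermTy.costBounded`). Let `T` be the complexity function
and `runMax T` its running maximum, which is monotone even where `T` is not.  By induction on the
typing derivation, a term annotated with `([c₁, φ₁], …, [cₖ, φₖ]; O(ψ))` costs at most
`∑ cᵢ * runMax T (φᵢ u) + L * (ψ u + 1)` on problems of size `u ≥ L`, where `L` depends on the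
derivation and on the auxiliary functions but not on the arguments.  That calls of the recursive
function cost at most `T` of their size is the definition of `T`, so no induction on sizes is needed.

*Recurrences* (`Pattern.bigO`). For the body, the estimate is a recurrence for `T`, and for each of
the patterns it is solved by the substitution method (`le_of_recurrence`).  Problems of size below `L`
do not matter, as `T` is finite there.
-/

namespace SynPlexity

/-! ### Substitution -/

theorem extend_none_orElse {ι β : Type*} (xs : ι → Var) (σ σ' : Var → Option β) :
    (fun x => (Function.extend xs (fun _ => none) σ x).or
        (Function.extend xs (fun _ => none) σ' x)) =
      Function.extend xs (fun _ => none) fun x => (σ x).or (σ' x) := by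
  funext x
  by_cases h : ∃ i, xs i = x <;> simp [Function.extend, h]

/-- Substitutions compose, provided that the terms put in by the first one are closed. -/
theorem Tm.subst_subst (t : Tm) (σ σ' : Var → Option Val) (θ θ' : Var → Option Tm)
    (hθ : ∀ g s, θ g = some s → s.Closed) :
    (t.subst σ θ).subst σ' θ' = t.subst (fun x => (σ x).or (σ' x)) fun g => (θ g).or (θ' g) := by
  induction t generalizing σ σ' θ θ' with
  | var x => cases h : σ x <;> simp [Tm.subst, h]
  | fvar g =>
    cases h : θ g with
    | none => simp [Tm.subst, h]
    | some s => simpa [Tm.subst, h] using hθ g s h σ' θ'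
  | const v => simp [Tm.subst]
  | con C n es ih => simp only [Tm.subst]; congr 1; funext i; exact ih i _ _ _ _ hθ
  | prim n o es ih => simp only [Tm.subst]; congr 1; funext i; exact ih i _ _ _ _ hθ
  | app h n es ihh ih =>
    simp only [Tm.subst]; congr 1
    · exact ihh _ _ _ _ hθ
    · funext i; exact ih i _ _ _ _ hθ
  | ite e t₁ t₂ ihe ih₁ ih₂ =>
    simp only [Tm.subst]; rw [ihe _ _ _ _ hθ, ih₁ _ _ _ _ hθ, ih₂ _ _ _ _ hθ]
  | mtch e m C k xs t ihe ih =>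
    simp only [Tm.subst]; congr 1
    · exact ihe _ _ _ _ hθ
    · funext i; rw [ih i _ _ _ _ hθ, extend_none_orElse]
  | fix f n xs t ih =>
    simp only [Tm.subst]; congr 1
    rw [ih, extend_none_orElse]
    · congr 1
      funext g
      by_cases h : g = f <;> simp [Function.update, h]
    · intro g s
      by_cases h : g = f
      · simp [Function.update, h]
      · simpa [Function.update, h] using hθ g s
  | tick c t ih => simp only [Tm.subst]; rw [ih _ _ _ _ hθ]

/-- Putting values for the bound variables into the body of a branch, the rest of which is already
closed, amounts to closing the branch with the extended valuation. -/
theorem Tm.subst_branch {ι : Type*} (t : Tm) (xs : ι → Var) (ws : ι → Val) (ρ : Store)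
    (θ : Var → Tm) (hθ : ∀ g, (θ g).Closed) :
    (t.subst (Function.extend xs (fun _ => none) fun x => some (ρ x)) fun g => some (θ g)).subst
        (Function.extend xs (fun i => some (ws i)) fun _ => none) (fun _ => none) =
      t.close (Function.extend xs ws ρ) θ := by
  rw [Tm.subst_subst]
  · unfold Tm.close
    congr 1
    funext x
    by_cases h : ∃ i, xs i = x <;> simp [Function.extend, h]
  · rintro g s ⟨⟩; exact hθ g

/-- Calling a closed function term amounts to closing its body with the valuation extended by the
arguments and with the function itself as the implementation of the recursive function. -/
theorem Tm.subst_body (f : Var) {n : ℕ} (xs : Fin n → Var) (t : Tm) (ws : Fin n → Val) (ρ : Store)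
    (θ : Var → Tm) (hθ : ∀ g, (θ g).Closed) (s : Tm) :
    (t.subst (Function.extend xs (fun _ => none) fun x => some (ρ x))
        (Function.update (fun g => some (θ g)) f none)).subst
        (Function.extend xs (fun i => some (ws i)) fun _ => none)
        (Function.update (fun _ => none) f (some s)) =
      t.close (Function.extend xs ws ρ) (Function.update θ f s) := by
  rw [Tm.subst_subst]
  · unfold Tm.close
    congr 1
    · funext x
      by_cases h : ∃ i, xs i = x <;> simp [Function.extend, h]
    · funext g
      by_cases h : g = f <;> simp [Function.update, h]
  · intro g s
    by_cases h : g = f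
    · simp [Function.update, h]
    · simp only [Function.update, h, dite_false, Option.some.injEq]
      rintro rfl; exact hθ g

theorem Tm.closed_close_fix (f : Var) {n : ℕ} (xs : Fin n → Var) (t : Tm) (ρ : Store)
    (θ : Var → Tm) (hθ : ∀ g, (θ g).Closed) : (Tm.close (.fix f n xs t) ρ θ).Closed := by
  intro σ' θ'
  unfold Tm.close
  rw [Tm.subst_subst]
  · simp
  · rintro g s ⟨⟩; exact hθ g

/-! ### Evaluations with a step count -/

theorem Step.shift {t t' : Tm} {C C' : ℕ} (h : Step (t, C) (t', C')) :
    ∃ Δ, C' = C + Δ ∧ ∀ C₀, Step (t, C₀) (t', C₀ + Δ) := by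
  cases h with
  | tick c => exact ⟨c, rfl, fun _ => .tick _ _ _⟩
  | app f n xs t es ws _ hes => exact ⟨0, rfl, fun _ => .app _ _ _ _ _ _ _ hes⟩
  | appArg f m xs t n es i e' _ Δ hval hs =>
    exact ⟨Δ, rfl, fun _ => .appArg _ _ _ _ _ _ _ _ _ _ hval hs⟩
  | con K n es ws _ hes => exact ⟨0, rfl, fun _ => .con _ _ _ _ _ hes⟩
  | conArg K n es i e' _ Δ hval hs => exact ⟨Δ, rfl, fun _ => .conArg _ _ _ _ _ _ _ hval hs⟩
  | prim n o es ws _ hes => exact ⟨0, rfl, fun _ => .prim _ _ _ _ _ hes⟩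
  | primArg n o es i e' _ Δ hval hs => exact ⟨Δ, rfl, fun _ => .primArg _ _ _ _ _ _ _ hval hs⟩
  | condTrue => exact ⟨0, rfl, fun _ => .condTrue _ _ _⟩
  | condFalse => exact ⟨0, rfl, fun _ => .condFalse _ _ _⟩
  | condGuard e e' t₁ t₂ _ Δ hs => exact ⟨Δ, rfl, fun _ => .condGuard _ _ _ _ _ _ hs⟩
  | mtch v m K k xs t i ws _ hv => exact ⟨0, rfl, fun _ => .mtch _ _ _ _ _ _ _ _ _ hv⟩
  | mtchScrutinee e e' m K k xs t _ Δ hs =>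
    exact ⟨Δ, rfl, fun _ => .mtchScrutinee _ _ _ _ _ _ _ _ _ hs⟩

/-- `Run k t v C`: the term `t` evaluates to the value `v` in `k` steps, with resource usage `C`. -/
inductive Run : ℕ → Tm → Val → ℕ → Prop
  | done (v : Val) : Run 0 (.const v) v 0
  | step (k : ℕ) (t t' : Tm) (v : Val) (Δ C : ℕ) (hstep : Step (t, 0) (t', Δ))
      (hrun : Run k t' v C) : Run (k + 1) t v (Δ + C)

theorem Run.evaluates {k : ℕ} {t : Tm} {v : Val} {C : ℕ} (h : Run k t v C) :
    Evaluates t v C := by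
  suffices ∀ C₀, Relation.ReflTransGen Step (t, C₀) (.const v, C₀ + C) by
    simpa [Evaluates] using this 0
  induction h with
  | done v => exact fun _ => .refl
  | step k t t' v Δ C hs _ ih =>
    intro C₀
    obtain ⟨Δ', h, hs'⟩ := hs.shift
    rw [zero_add] at h
    subst h
    have := ih (C₀ + Δ)
    rw [add_assoc] at this
    exact .head (hs' C₀) this

theorem Evaluates.run {t : Tm} {v : Val} {C : ℕ} (h : Evaluates t v C) : ∃ k, Run k t v C := by
  suffices ∀ p : Tm × ℕ, Relation.ReflTransGen Step p (.const v, C) →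
      ∃ k Δ, C = p.2 + Δ ∧ Run k p.1 v Δ by
    obtain ⟨k, Δ, hC, hr⟩ := this _ h
    rw [zero_add] at hC
    exact ⟨k, hC ▸ hr⟩
  intro p hp
  induction hp using Relation.ReflTransGen.head_induction_on with
  | refl => exact ⟨0, 0, rfl, .done v⟩
  | @head p q hs _ ih =>
    obtain ⟨k, Δ, hC, hr⟩ := ih
    obtain ⟨Δ', h, hs'⟩ := Step.shift (t := p.1) (C := p.2) (t' := q.1) (C' := q.2) hs
    have := hs' 0
    rw [zero_add] at this
    exact ⟨k + 1, Δ' + Δ, by omega, .step _ _ _ _ _ _ this hr⟩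

theorem Run.const_inv {k : ℕ} {w v : Val} {C : ℕ} (h : Run k (.const w) v C) :
    v = w ∧ C = 0 := by
  cases h with
  | done => exact ⟨rfl, rfl⟩
  | step _ _ _ _ _ _ hs => cases hs

/-- The tuple of terms `es` evaluates to the tuple `ws` with resource usages `Cs`, every component
in at most `N` steps. -/
def RunArgs {n : ℕ} (N : ℕ) (es : Fin n → Tm) (ws : Fin n → Val) (Cs : Fin n → ℕ) : Prop :=
  ∀ i, ∃ k ≤ N, Run k (es i) (ws i) (Cs i)

theorem RunArgs.of_const {n N : ℕ} {es : Fin n → Tm} {ws : Fin n → Val}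
    (h : ∀ i, es i = .const (ws i)) : RunArgs N es ws fun _ => 0 :=
  fun i => ⟨0, N.zero_le, h i ▸ .done _⟩

theorem RunArgs.cons {n N : ℕ} {es : Fin n → Tm} {ws : Fin n → Val} {Cs : Fin n → ℕ} {i : Fin n}
    {e' : Tm} {Δ : ℕ} (hs : Step (es i, 0) (e', Δ))
    (h : RunArgs N (Function.update es i e') ws Cs) :
    RunArgs (N + 1) es ws fun j => (if j = i then Δ else 0) + Cs j := by
  intro j
  obtain ⟨k, hk, hr⟩ := h j
  by_cases hj : j = i
  · subst hj
    rw [Function.update_self] at hr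
    exact ⟨k + 1, by omega, by simpa using Run.step _ _ _ _ _ _ hs hr⟩
  · rw [Function.update_of_ne hj] at hr
    exact ⟨k, by omega, by simpa [hj] using hr⟩

theorem sum_cost_cons {n : ℕ} (i : Fin n) (Δ : ℕ) (Cs : Fin n → ℕ) :
    ∑ j, ((if j = i then Δ else 0) + Cs j) = Δ + ∑ j, Cs j := by
  simp [Finset.sum_add_distrib]

/-- A call evaluates its arguments before the function is entered. -/
theorem Run.app_inv {N : ℕ} {f : Var} {m : ℕ} {xs : Fin m → Var} {t : Tm} {n : ℕ}
    {es : Fin n → Tm} {v : Val} {C : ℕ} (h : Run N (.app (.fix f m xs t) n es) v C) :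
    ∃ (ws : Fin n → Val) (Cs : Fin n → ℕ) (k C' : ℕ), RunArgs N es ws Cs ∧ k ≤ N ∧
      Run k (.app (.fix f m xs t) n fun i => .const (ws i)) v C' ∧ C = ∑ i, Cs i + C' := by
  generalize hs : Tm.app (.fix f m xs t) n es = s at h
  induction h generalizing es with
  | done => cases hs
  | step k _ t' v Δ C hstep hr ih =>
    subst hs
    cases hstep with
    | app _ _ _ _ _ ws _ hes =>
      obtain rfl := funext hes
      exact ⟨ws, fun _ => 0, k + 1, 0 + C, .of_const hes, le_rfl,
        .step _ _ _ _ _ _ (.app _ _ _ _ _ _ _ hes) hr, by simp⟩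
    | appArg _ _ _ _ _ _ i e' _ Δ' hval hs' =>
      obtain ⟨ws, Cs, k', C', ha, hk, hr', hC⟩ := ih rfl
      exact ⟨ws, _, k', C', ha.cons hs', by omega, hr', by rw [sum_cost_cons]; omega⟩

theorem Run.call_inv {N : ℕ} {f : Var} {n : ℕ} {xs : Fin n → Var} {t : Tm} {ws : Fin n → Val}
    {v : Val} {C : ℕ} (h : Run N (.app (.fix f n xs t) n fun i => .const (ws i)) v C) :
    ∃ k < N, Run k (t.subst (Function.extend xs (fun i => some (ws i)) fun _ => none)
      (Function.update (fun _ => none) f (some (.fix f n xs t)))) v C := by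
  cases h with
  | step k _ t' _ Δ C hstep hr =>
    cases hstep with
    | app _ _ _ _ _ ws' _ hes =>
      obtain rfl : ws = ws' := funext fun i => by simpa using hes i
      exact ⟨k, by omega, by simpa using hr⟩
    | appArg _ _ _ _ _ _ i e' _ Δ' hval hs' => cases hs'

theorem Run.con_inv {N : ℕ} {K : Con} {n : ℕ} {es : Fin n → Tm} {v : Val} {C : ℕ}
    (h : Run N (.con K n es) v C) :
    ∃ (ws : Fin n → Val) (Cs : Fin n → ℕ), RunArgs N es ws Cs ∧ v = .con K n ws ∧
      C = ∑ i, Cs i := by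
  generalize hs : Tm.con K n es = s at h
  induction h generalizing es with
  | done => cases hs
  | step k _ t' v Δ C hstep hr ih =>
    subst hs
    cases hstep with
    | con _ _ _ ws _ hes =>
      obtain ⟨rfl, rfl⟩ := hr.const_inv
      exact ⟨ws, fun _ => 0, .of_const hes, rfl, by simp⟩
    | conArg _ _ _ i e' _ Δ' hval hs' =>
      obtain ⟨ws, Cs, ha, hv, hC⟩ := ih rfl
      exact ⟨ws, _, ha.cons hs', hv, by rw [sum_cost_cons]; omega⟩

theorem Run.ite_inv {N : ℕ} {e t₁ t₂ : Tm} {v : Val} {C : ℕ} (h : Run N (.ite e t₁ t₂) v C) :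
    ∃ (b : Bool) (k₁ k₂ C₁ C₂ : ℕ), k₁ ≤ N ∧ k₂ ≤ N ∧ Run k₁ e (.bool b) C₁ ∧
      Run k₂ (bif b then t₁ else t₂) v C₂ ∧ C = C₁ + C₂ := by
  generalize hs : Tm.ite e t₁ t₂ = s at h
  induction h generalizing e with
  | done => cases hs
  | step k _ t' v Δ C hstep hr ih =>
    subst hs
    cases hstep with
    | condTrue => exact ⟨true, 0, k, 0, C, by omega, by omega, .done _, hr, rfl⟩
    | condFalse => exact ⟨false, 0, k, 0, C, by omega, by omega, .done _, hr, rfl⟩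
    | condGuard _ e' _ _ _ Δ' hs' =>
      obtain ⟨b, k₁, k₂, C₁, C₂, h₁, h₂, hr₁, hr₂, hC⟩ := ih rfl
      exact ⟨b, k₁ + 1, k₂, Δ' + C₁, C₂, by omega, by omega, .step _ _ _ _ _ _ hs' hr₁, hr₂,
        by omega⟩

theorem Run.mtch_inv {N : ℕ} {e : Tm} {m : ℕ} {K : Fin m → Con} {ar : Fin m → ℕ}
    {xs : ∀ i, Fin (ar i) → Var} {t : Fin m → Tm} {v : Val} {C : ℕ}
    (h : Run N (.mtch e m K ar xs t) v C) :
    ∃ (i : Fin m) (ws : Fin (ar i) → Val) (k₁ k₂ C₁ C₂ : ℕ), k₁ ≤ N ∧ k₂ ≤ N ∧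
      Run k₁ e (.con (K i) (ar i) ws) C₁ ∧
      Run k₂ ((t i).subst (Function.extend (xs i) (fun j => some (ws j)) fun _ => none)
        fun _ => none) v C₂ ∧ C = C₁ + C₂ := by
  generalize hs : Tm.mtch e m K ar xs t = s at h
  induction h generalizing e with
  | done => cases hs
  | step k _ t' v Δ C hstep hr ih =>
    subst hs
    cases hstep with
    | mtch _ _ _ _ _ _ i ws _ hv =>
      subst hv
      exact ⟨i, ws, 0, k, 0, C, by omega, by omega, .done _, hr, rfl⟩
    | mtchScrutinee _ e' _ _ _ _ _ _ Δ' hs' =>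
      obtain ⟨i, ws, k₁, k₂, C₁, C₂, h₁, h₂, hr₁, hr₂, hC⟩ := ih rfl
      exact ⟨i, ws, k₁ + 1, k₂, Δ' + C₁, C₂, by omega, by omega, .step _ _ _ _ _ _ hs' hr₁, hr₂,
        by omega⟩

/-! ### Environments and valuations -/

@[simp] theorem Env.vars_assume (Γ : Env) (p : Store → Prop) : (Γ.assume p).vars = Γ.vars := by
  simp [Env.vars, Env.assume]

@[simp] theorem Env.vars_branch (𝒟 : DataSig) (Γ : Env) (τ : RTy) (C : Con)
    (xs : Fin (𝒟.arity C) → Var) : (Γ.branch 𝒟 τ C xs).vars = Γ.vars ∪ Set.range xs := by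
  ext x
  simp only [Env.vars, Env.branch, List.mem_append, List.mem_cons, List.mem_ofFn, Set.mem_ofPred_eq,
    Set.mem_union, Set.mem_range, List.cons_append, reduceCtorEq, false_or]
  constructor
  · rintro ⟨τ', α', ⟨j, hj⟩ | h⟩
    · cases hj; exact .inr ⟨j, rfl⟩
    · exact .inl ⟨_, _, h⟩
  · rintro (⟨τ', α', h⟩ | ⟨j, rfl⟩)
    · exact ⟨_, _, .inr h⟩
    · exact ⟨_, _, .inl ⟨j, rfl⟩⟩

@[simp] theorem Env.vars_enter (Γ : Env) (f : Var) {n : ℕ} (F : FunTy n) (B : Bound) :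
    (Γ.enter f F B).vars = Γ.vars ∪ Set.range F.params := by
  ext x
  simp only [Env.vars, Env.enter, List.mem_append, List.mem_cons, List.mem_ofFn, Set.mem_ofPred_eq,
    Set.mem_union, Set.mem_range, List.cons_append, reduceCtorEq, false_or]
  constructor
  · rintro ⟨τ', α', ⟨j, hj⟩ | h⟩
    · cases hj; exact .inr ⟨j, rfl⟩
    · exact .inl ⟨_, _, h⟩
  · rintro (⟨τ', α', h⟩ | ⟨j, rfl⟩)
    · exact ⟨_, _, .inr h⟩
    · exact ⟨_, _, .inl ⟨j, rfl⟩⟩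

theorem Env.fn_mem_assume {Γ : Env} {p : Store → Prop} {g : Var} {n : ℕ} {F : FunTy n}
    {ψ : Bound} : Entry.fn g n F ψ ∈ (Γ.assume p).entries ↔ Entry.fn g n F ψ ∈ Γ.entries := by
  simp [Env.assume]

theorem Env.fn_mem_branch {𝒟 : DataSig} {Γ : Env} {τ : RTy} {C : Con}
    {xs : Fin (𝒟.arity C) → Var} {g : Var} {n : ℕ} {F : FunTy n} {ψ : Bound} :
    Entry.fn g n F ψ ∈ (Γ.branch 𝒟 τ C xs).entries ↔ Entry.fn g n F ψ ∈ Γ.entries := by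
  simp [Env.branch, List.mem_ofFn]

theorem eqOn_extend {ι β : Type*} (xs : ι → Var) (ws : ι → β) (ρ : Var → β) {S : Set Var}
    (h : ∀ i, xs i ∉ S) : Set.EqOn ρ (Function.extend xs ws ρ) S := by
  intro x hx
  rw [Function.extend_apply']
  rintro ⟨i, rfl⟩
  exact h i hx

theorem eqOn_extend_extend {ι β : Type*} (xs : ι → Var) (ws : ι → β) {ρ ρ' : Var → β} {S : Set Var}
    (h : Set.EqOn ρ ρ' S) :
    Set.EqOn (Function.extend xs ws ρ) (Function.extend xs ws ρ') (S ∪ Set.range xs) := by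
  intro x hx
  by_cases hx' : ∃ i, xs i = x
  · simp [Function.extend, hx']
  · rw [Function.extend_apply' _ _ _ hx', Function.extend_apply' _ _ _ hx']
    exact h (hx.resolve_right hx')

/-- All valuations that agree with `ρ` on the variables of `Γ` are instances of `Γ`.

Subsumption may put unbound variables into the refinement of a guard or scrutinee, and hence into
the path conditions of the branches, and such a variable may be bound later.  This notion, unlike
`Env.Sat`, is stable under such a binding. -/
def Env.StrongSat (𝒟 : DataSig) (Γ : Env) (ρ : Store) : Prop :=
  ∀ ρ', Set.EqOn ρ ρ' Γ.vars → Γ.Sat 𝒟 ρ'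

theorem Env.StrongSat.sat {𝒟 : DataSig} {Γ : Env} {ρ : Store} (h : Γ.StrongSat 𝒟 ρ) :
    Γ.Sat 𝒟 ρ := h ρ (Set.eqOn_refl _ _)

theorem Env.Scoped.strongSat {𝒟 : DataSig} {Γ : Env} (hΓ : Γ.Scoped) {ρ : Store}
    (h : Γ.Sat 𝒟 ρ) : Γ.StrongSat 𝒟 ρ := by
  intro ρ' hρ
  refine ⟨fun x τ α hx => ?_, fun p hp => (hΓ.2.2 p hp ρ ρ' hρ).1 (h.2 p hp)⟩
  rw [← hρ ⟨τ, α, hx⟩]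
  exact ⟨(h.1 x τ α hx).1, (hΓ.1 x τ α hx ρ ρ' hρ _).1 (h.1 x τ α hx).2⟩

theorem FunTy.Scoped.inputs_iff {𝒟 : DataSig} {n : ℕ} {F : FunTy n} {S : Set Var}
    (hF : F.Scoped S) {ρ ρ' : Store} (h : Set.EqOn ρ ρ' S) (ws : Fin n → Val) :
    F.Inputs 𝒟 ρ ws ↔ F.Inputs 𝒟 ρ' ws :=
  forall_congr' fun i => and_congr_right fun _ =>
    hF.1 i _ _ (eqOn_extend_extend F.params ws h) _

theorem FunTy.Scoped.cod_mem_iff {𝒟 : DataSig} {n : ℕ} {F : FunTy n} {S : Set Var}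
    (hF : F.Scoped S) {ρ ρ' : Store} (h : Set.EqOn ρ ρ' S) (ws : Fin n → Val) (v : Val) :
    F.cod.Mem 𝒟 (F.set ρ ws) v ↔ F.cod.Mem 𝒟 (F.set ρ' ws) v :=
  and_congr_right fun _ => hF.2 _ _ (eqOn_extend_extend F.params ws h) _

theorem Env.enter_strongSat {𝒟 : DataSig} {Γ : Env} (f : Var) {n : ℕ} {F : FunTy n} {B : Bound}
    (hinj : Function.Injective F.params) (hfresh : ∀ i, F.params i ∉ Γ.vars)
    (hscope : F.Scoped Γ.vars) {ρ : Store} (hsat : Γ.StrongSat 𝒟 ρ) {ws : Fin n → Val}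
    (hws : F.Inputs 𝒟 ρ ws) : (Γ.enter f F B).StrongSat 𝒟 (F.set ρ ws) := by
  intro ρ' hρ
  rw [Env.vars_enter] at hρ
  have hΓ : Γ.Sat 𝒟 ρ' :=
    hsat ρ' ((eqOn_extend _ _ _ hfresh).trans (hρ.mono Set.subset_union_left))
  constructor
  · intro x τ α hx
    simp only [Env.enter, List.cons_append, List.mem_cons, reduceCtorEq, false_or,
      List.mem_append, List.mem_ofFn] at hx
    obtain ⟨i, hi⟩ | hx := hx
    · cases hi
      rw [← hρ (.inr ⟨i, rfl⟩)]
      have : F.set ρ ws (F.params i) = ws i := hinj.extend_apply _ _ _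
      rw [this]
      exact ⟨(hws i).1, (hscope.1 i _ _ hρ _).1 (hws i).2⟩
    · exact hΓ.1 x τ α hx
  · intro p hp
    simp only [Env.enter, List.cons_append, List.mem_cons, reduceCtorEq, false_or,
      List.mem_append, List.mem_ofFn, exists_false] at hp
    exact hΓ.2 p hp

/-! ### Type soundness -/

/-- The results of `fn` on the inputs of type `F` that are computed in at most `N` steps have the
result type of `F`. -/
def Meets (𝒟 : DataSig) (N : ℕ) {n : ℕ} (F : FunTy n) (ρ : Store) (fn : Tm) : Prop :=
  (∃ f xs t, fn = .fix f n xs t) ∧ ∀ ws, F.Inputs 𝒟 ρ ws → ∀ k ≤ N, ∀ v C,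
    Run k (.app fn n fun i => .const (ws i)) v C → F.cod.Mem 𝒟 (F.set ρ ws) v

/-- The implementations `θ` meet the types of the functions of `Γ`, for evaluations of at most `N`
steps and for all valuations that agree with `ρ₀` on `V`. -/
def Env.MeetsTypes (𝒟 : DataSig) (N : ℕ) (Γ : Env) (V : Set Var) (ρ₀ : Store) (θ : Var → Tm) :
    Prop :=
  ∀ g n (F : FunTy n) ψ, Entry.fn g n F ψ ∈ Γ.entries → ∀ ρ, Set.EqOn ρ₀ ρ V →
    Meets 𝒟 N F ρ (θ g)

section

variable {𝒟 : DataSig} {size : SizeFun} {Γ : Env} {V : Set Var} {ρ₀ ρ : Store} {θ : Var → Tm}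
  {N : ℕ}

theorem FunNameTy.meets {g : Var} {n : ℕ} {F : FunTy n} {ψ : Bound}
    (h : FunNameTy 𝒟 Γ g n F ψ) (hθ : Γ.MeetsTypes 𝒟 N V ρ₀ θ) (hρ : Set.EqOn ρ₀ ρ V)
    (hsat : Γ.Sat 𝒟 ρ) : Meets 𝒟 N F ρ (θ g) := by
  induction h with
  | var F ψ hmem => exact hθ g n F ψ hmem ρ hρ
  | sub F F' ψ ψ' hty hF hψ ih =>
    refine ⟨ih.1, fun ws hws k hk v C hr => ?_⟩
    obtain ⟨hws', hcod⟩ := hF.2.2 ρ hsat ws hws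
    have := ih.2 ws hws' k hk v C hr
    exact ⟨hF.2.1 ▸ this.1, hcod v this⟩

/-- Only the variables of the environment occur in a typable E-term. -/
theorem ETermTy.close_congr {e : Tm} {τ : RTy} {α : Ann} (h : ETermTy 𝒟 size Γ e τ α)
    {ρ' : Store} (hρ : Set.EqOn ρ ρ' Γ.vars) : e.close ρ θ = e.close ρ' θ := by
  induction h with
  | sub e τ τ' α α' hty hτ hα ih => exact ih
  | var x τ α hmem => simp [Tm.close, Tm.subst, hρ ⟨_, _, hmem⟩]
  | const v B hv => simp [Tm.close, Tm.subst]
  | con C es τs αs α hshare hes harg ih =>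
    simp only [Tm.close, Tm.subst]
    congr 1
    exact funext ih
  | app g m F ψg es τs αs α hg hrec hshare hes harg hcost ih =>
    simp only [Tm.close, Tm.subst]
    congr 1
    exact funext ih
  | recApp f m F ψf es τs αs l₁ l₂ c φ ψ hf hrec hshare hes harg hsize ih =>
    simp only [Tm.close, Tm.subst]
    congr 1
    exact funext ih

/-- An evaluation of the call of a function consists of evaluations of the arguments and of a call
on the resulting values. -/
theorem Run.app_close_inv {g : Var} {m k : ℕ} {F : FunTy m} {es : Fin m → Tm}
    (hm : Meets 𝒟 N F ρ (θ g)) {v : Val} {C : ℕ}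
    (hr : Run k (Tm.close (.app (.fvar g) m es) ρ θ) v C) :
    ∃ (ws : Fin m → Val) (Cs : Fin m → ℕ) (k' C' : ℕ),
      RunArgs k (fun i => (es i).close ρ θ) ws Cs ∧ k' ≤ k ∧
      Run k' (.app (θ g) m fun i => .const (ws i)) v C' ∧ C = ∑ i, Cs i + C' := by
  obtain ⟨f, xs, t, hfix⟩ := hm.1
  have : Tm.close (.app (.fvar g) m es) ρ θ = .app (.fix f m xs t) m fun i => (es i).close ρ θ := by
    simp [Tm.close, Tm.subst, hfix]
  rw [this] at hr
  rw [hfix]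
  exact hr.app_inv

theorem ETermTy.sound {e : Tm} {τ : RTy} {α : Ann} (h : ETermTy 𝒟 size Γ e τ α)
    (hθ : Γ.MeetsTypes 𝒟 N V ρ₀ θ) (hρ : Set.EqOn ρ₀ ρ V) (hsat : Γ.Sat 𝒟 ρ) :
    ∀ k ≤ N, ∀ v C, Run k (e.close ρ θ) v C → τ.Mem 𝒟 ρ v := by
  induction h with
  | sub e τ τ' α α' hty hτ hα ih =>
    intro k hk v C hr
    have := ih k hk v C hr
    exact ⟨hτ.1 ▸ this.1, hτ.2 ρ hsat v this⟩
  | var x τ α hmem =>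
    intro k hk v C hr
    simp only [Tm.close, Tm.subst, Option.elim] at hr
    obtain ⟨rfl, -⟩ := hr.const_inv
    have := hsat.1 x τ α hmem
    exact ⟨this.1, this.2, rfl⟩
  | const w B hv =>
    intro k hk v C hr
    simp only [Tm.close, Tm.subst] at hr
    obtain ⟨rfl, -⟩ := hr.const_inv
    exact ⟨hv, rfl⟩
  | con K es τs αs α hshare hes harg ih =>
    intro k hk v C hr
    simp only [Tm.close, Tm.subst] at hr
    obtain ⟨ws, Cs, ha, rfl, -⟩ := hr.con_inv
    have hws : ∀ i, (τs i).Mem 𝒟 ρ (ws i) := fun i =>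
      let ⟨k', hk', hr'⟩ := ha i; ih i k' (hk'.trans hk) _ _ hr'
    have hbase : ∀ i, 𝒟.HasBase (𝒟.argBase K i) (ws i) := fun i => by
      have := (hws i).1
      rwa [(harg i).1] at this
    exact ⟨.con K ws hbase fun i => (harg i).2 ρ hsat _ (hws i), ws, hws, rfl⟩
  | app g m F ψg es τs αs α hg hrec hshare hes harg hcost ih =>
    intro k hk v C hr
    have hm := hg.meets hθ hρ hsat
    obtain ⟨ws, Cs, k', C', ha, hk', hr', -⟩ := hr.app_close_inv hm
    have hws : ∀ i, (τs i).Mem 𝒟 ρ (ws i) := fun i =>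
      let ⟨k', hk', hr'⟩ := ha i; ih i k' (hk'.trans hk) _ _ hr'
    have := hm.2 ws (harg.2 ρ hsat ws hws) k' (hk'.trans hk) v C' hr'
    exact ⟨this.1, ws, hws, this.2⟩
  | recApp f m F ψf es τs αs l₁ l₂ c φ ψ hf hrec hshare hes harg hsize ih =>
    intro k hk v C hr
    have hm := hf.meets hθ hρ hsat
    obtain ⟨ws, Cs, k', C', ha, hk', hr', -⟩ := hr.app_close_inv hm
    have hws : ∀ i, (τs i).Mem 𝒟 ρ (ws i) := fun i =>
      let ⟨k', hk', hr'⟩ := ha i; ih i k' (hk'.trans hk) _ _ hr'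
    have := hm.2 ws (harg.2 ρ hsat ws hws) k' (hk'.trans hk) v C' hr'
    exact ⟨this.1, ws, hws, this.2⟩

/-- Soundness of E-terms for all valuations that agree on the variables of the environment. -/
theorem ETermTy.sound_of_eqOn {e : Tm} {τ : RTy} {α : Ann} (h : ETermTy 𝒟 size Γ e τ α)
    (hV : V ⊆ Γ.vars) (hθ : Γ.MeetsTypes 𝒟 N V ρ₀ θ) (hρ : Set.EqOn ρ₀ ρ V)
    (hsat : Γ.StrongSat 𝒟 ρ) {k : ℕ} (hk : k ≤ N) {v : Val} {C : ℕ}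
    (hr : Run k (e.close ρ θ) v C) {ρ' : Store} (hρ' : Set.EqOn ρ ρ' Γ.vars) :
    τ.Mem 𝒟 ρ' v :=
  h.sound hθ (hρ.trans (hρ'.mono hV)) (hsat ρ' hρ') k hk v C (h.close_congr hρ' ▸ hr)

theorem ETermTy.assume_strongSat {e : Tm} {φ : Store → Val → Prop} {α : Ann} {b : Bool}
    (h : ETermTy 𝒟 size Γ e ⟨.bool, φ⟩ α) (hV : V ⊆ Γ.vars) (hθ : Γ.MeetsTypes 𝒟 N V ρ₀ θ)
    (hρ : Set.EqOn ρ₀ ρ V) (hsat : Γ.StrongSat 𝒟 ρ) {k : ℕ} (hk : k ≤ N) {C : ℕ}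
    (hr : Run k (e.close ρ θ) (.bool b) C) :
    (Γ.assume fun ρ => φ ρ (.bool b)).StrongSat 𝒟 ρ := by
  intro ρ' hρ'
  rw [Env.vars_assume] at hρ'
  refine ⟨fun x τ α hx => (hsat ρ' hρ').1 x τ α (by simpa [Env.assume] using hx), fun p hp => ?_⟩
  simp only [Env.assume, List.mem_cons, Entry.path.injEq] at hp
  obtain rfl | hp := hp
  · exact (h.sound_of_eqOn hV hθ hρ hsat hk hr hρ').2
  · exact (hsat ρ' hρ').2 p hp

theorem DataSig.HasBase.con_inv {D : DName} {K : Con} {ws : Fin (𝒟.arity K) → Val}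
    (h : 𝒟.HasBase (.data D) (.con K (𝒟.arity K) ws)) (j : Fin (𝒟.arity K)) :
    𝒟.HasBase (𝒟.argBase K j) (ws j) ∧ 𝒟.argRef K j (ws j) := by
  generalize hv : Val.con K (𝒟.arity K) ws = v at h
  cases h with
  | con K' ws' hb hr =>
    simp only [Val.con.injEq] at hv
    obtain ⟨rfl, -, h⟩ := hv
    cases h
    exact ⟨hb j, hr j⟩

theorem ETermTy.branch_strongSat {e : Tm} {τ : RTy} {α : Ann} {D : DName} {K : Con}
    {xs : Fin (𝒟.arity K) → Var} {ws : Fin (𝒟.arity K) → Val}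
    (h : ETermTy 𝒟 size Γ e τ α) (hD : τ.base = .data D) (hinj : Function.Injective xs)
    (hfresh : ∀ j, xs j ∉ Γ.vars) (hV : V ⊆ Γ.vars) (hθ : Γ.MeetsTypes 𝒟 N V ρ₀ θ)
    (hρ : Set.EqOn ρ₀ ρ V) (hsat : Γ.StrongSat 𝒟 ρ) {k : ℕ} (hk : k ≤ N) {C : ℕ}
    (hr : Run k (e.close ρ θ) (.con K (𝒟.arity K) ws) C) :
    (Γ.branch 𝒟 τ K xs).StrongSat 𝒟 (Function.extend xs ws ρ) := by
  intro ρ' hρ'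
  rw [Env.vars_branch] at hρ'
  have hρρ' : Set.EqOn ρ ρ' Γ.vars :=
    (eqOn_extend _ _ _ hfresh).trans (hρ'.mono Set.subset_union_left)
  have hws : ∀ j, ρ' (xs j) = ws j := fun j => by
    rw [← hρ' (.inr ⟨j, rfl⟩), hinj.extend_apply]
  have hmem := h.sound_of_eqOn hV hθ hρ hsat hk hr hρρ'
  constructor
  · intro x τ' α' hx
    simp only [Env.branch, List.cons_append, List.mem_cons, reduceCtorEq, false_or,
      List.mem_append, List.mem_ofFn] at hx
    obtain ⟨j, hj⟩ | hx := hx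
    · cases hj
      rw [hws]
      exact DataSig.HasBase.con_inv (hD ▸ hmem.1) j
    · exact (hsat ρ' hρρ').1 x τ' α' hx
  · intro p hp
    simp only [Env.branch, List.cons_append, List.mem_cons, Entry.path.injEq,
      List.mem_append, List.mem_ofFn, reduceCtorEq, exists_false, false_or] at hp
    obtain rfl | hp := hp
    · simp only [hws]
      exact hmem.2
    · exact (hsat ρ' hρρ').2 p hp

theorem Run.ite_close_inv {e t₁ t₂ : Tm} {k : ℕ} {v : Val} {C : ℕ}
    (hr : Run k (Tm.close (.ite e t₁ t₂) ρ θ) v C) :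
    ∃ (b : Bool) (k₁ k₂ C₁ C₂ : ℕ), k₁ ≤ k ∧ k₂ ≤ k ∧ Run k₁ (e.close ρ θ) (.bool b) C₁ ∧
      Run k₂ ((bif b then t₁ else t₂).close ρ θ) v C₂ ∧ C = C₁ + C₂ := by
  simp only [Tm.close, Tm.subst] at hr
  obtain ⟨b, k₁, k₂, C₁, C₂, h₁, h₂, hr₁, hr₂, hC⟩ := hr.ite_inv
  exact ⟨b, k₁, k₂, C₁, C₂, h₁, h₂, hr₁, by cases b <;> exact hr₂, hC⟩

theorem Run.mtch_close_inv {e : Tm} {m : ℕ} {K : Fin m → Con} {ar : Fin m → ℕ}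
    {xs : ∀ i, Fin (ar i) → Var} {t : Fin m → Tm} {k : ℕ} {v : Val} {C : ℕ}
    (hcl : ∀ g, (θ g).Closed) (hr : Run k (Tm.close (.mtch e m K ar xs t) ρ θ) v C) :
    ∃ (i : Fin m) (ws : Fin (ar i) → Val) (k₁ k₂ C₁ C₂ : ℕ), k₁ ≤ k ∧ k₂ ≤ k ∧
      Run k₁ (e.close ρ θ) (.con (K i) (ar i) ws) C₁ ∧
      Run k₂ ((t i).close (Function.extend (xs i) ws ρ) θ) v C₂ ∧ C = C₁ + C₂ := by
  simp only [Tm.close, Tm.subst] at hr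
  obtain ⟨i, ws, k₁, k₂, C₁, C₂, h₁, h₂, hr₁, hr₂, hC⟩ := hr.mtch_inv
  rw [Tm.subst_branch _ _ _ _ _ hcl] at hr₂
  exact ⟨i, ws, k₁, k₂, C₁, C₂, h₁, h₂, hr₁, hr₂, hC⟩

/-- The result has the type `τ` under an extension of `ρ`, namely by the values of the variables
bound by the matches that were evaluated. -/
theorem TermTy.sound {t : Tm} {τ : RTy} {α : Ann} (h : TermTy 𝒟 size Γ t τ α)
    (hcl : ∀ g, (θ g).Closed) (hV : V ⊆ Γ.vars) (hθ : Γ.MeetsTypes 𝒟 N V ρ₀ θ)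
    (hρ : Set.EqOn ρ₀ ρ V) (hsat : Γ.StrongSat 𝒟 ρ) {k : ℕ} (hk : k ≤ N) {v : Val} {C : ℕ}
    (hr : Run k (t.close ρ θ) v C) : ∃ ρ', Set.EqOn ρ ρ' Γ.vars ∧ τ.Mem 𝒟 ρ' v := by
  induction h generalizing ρ k C with
  | eterm Γ e τ α hty =>
    exact ⟨ρ, Set.eqOn_refl _ _, hty.sound hθ hρ hsat.sat k hk v C hr⟩
  | ite Γ e t₁ t₂ φ τ α α₁ α₂ hshare he h₁ h₂ ih₁ ih₂ =>
    obtain ⟨b, k₁, k₂, C₁, C₂, hk₁, hk₂, hr₁, hr₂, -⟩ := hr.ite_close_inv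
    have hs := he.assume_strongSat hV hθ hρ hsat (hk₁.trans hk) hr₁
    have hθ' : ∀ p, (Γ.assume p).MeetsTypes 𝒟 N V ρ₀ θ := fun p g n F ψ hg =>
      hθ g n F ψ (Env.fn_mem_assume.1 hg)
    cases b
    · simpa using ih₂ (by simpa using hV) (hθ' _) hρ hs (hk₂.trans hk) hr₂
    · simpa using ih₁ (by simpa using hV) (hθ' _) hρ hs (hk₂.trans hk) hr₂
  | mtch Γ e m K xs t D τs τ α α₁ α₂ hshare he hD hres hinj hfresh ht ih =>
    obtain ⟨i, ws, k₁, k₂, C₁, C₂, hk₁, hk₂, hr₁, hr₂, -⟩ := hr.mtch_close_inv hcl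
    have hs := he.branch_strongSat hD (hinj i) (hfresh i) hV hθ hρ hsat (hk₁.trans hk) hr₁
    have hext := eqOn_extend (xs i) ws ρ (hfresh i)
    obtain ⟨ρ', hρ', hmem⟩ := ih i (by rw [Env.vars_branch]; exact hV.trans Set.subset_union_left)
      (fun g n F ψ hg => hθ g n F ψ (Env.fn_mem_branch.1 hg)) (hρ.trans (hext.mono hV)) hs
      (hk₂.trans hk) hr₂
    rw [Env.vars_branch] at hρ'
    exact ⟨ρ', hext.trans (hρ'.mono Set.subset_union_left), hmem⟩

end

/-! ### Bounds and the cost that an annotation stands for -/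

theorem Bound.eval_nonneg (ψ : Bound) (u : ℕ) : 0 ≤ ψ.eval u := by
  have := Real.log_natCast_nonneg u
  unfold Bound.eval
  positivity

/-- Since finitely many exceptions are absorbed by a constant, membership in `O(ψ)` gives an
estimate that holds everywhere. -/
theorem BigO.exists_le {g : ℕ → ℝ} {ψ : Bound} (h : BigO g ψ.eval) :
    ∃ L : ℕ, ∀ u, g u ≤ L * (ψ.eval u + 1) := by
  obtain ⟨c, M, hM, hle⟩ := h
  obtain ⟨L, hL⟩ := exists_nat_ge (M + ∑ i ∈ Finset.range c, |g i|)
  have hsum : 0 ≤ ∑ i ∈ Finset.range c, |g i| := Finset.sum_nonneg fun _ _ => abs_nonneg _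
  refine ⟨L, fun u => ?_⟩
  have hψ := ψ.eval_nonneg u
  by_cases hu : c ≤ u
  · have := hle u hu
    nlinarith [mul_le_mul_of_nonneg_right hL hψ, mul_nonneg hsum hψ]
  · have h₁ : |g u| ≤ ∑ i ∈ Finset.range c, |g i| :=
      Finset.single_le_sum (f := fun i => |g i|) (fun _ _ => abs_nonneg _) (by simpa using hu)
    nlinarith [le_abs_self (g u), mul_nonneg (L.cast_nonneg (α := ℝ)) hψ]

/-- The running maximum `max {T s | s ≤ z}`, which is `0` for negative `z`. -/
def runMax (T : ℕ → ℕ) (z : ℤ) : ℕ := (Finset.range (z + 1).toNat).sup T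

theorem le_runMax (T : ℕ → ℕ) {s : ℕ} {z : ℤ} (h : (s : ℤ) ≤ z) : T s ≤ runMax T z :=
  Finset.le_sup (f := T) (Finset.mem_range.2 (by omega))

theorem runMax_le (T : ℕ → ℕ) {z : ℤ} {x : ℝ} (hx : 0 ≤ x)
    (h : ∀ s : ℕ, (s : ℤ) ≤ z → (T s : ℝ) ≤ x) : (runMax T z : ℝ) ≤ x := by
  rw [← Nat.le_floor_iff hx]
  refine Finset.sup_le fun s hs => Nat.le_floor (h s ?_)
  have := Finset.mem_range.1 hs
  omega

theorem runMax_mono (T : ℕ → ℕ) : Monotone (runMax T) := fun z z' h =>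
  Finset.sup_mono (Finset.range_subset_range.2 (by omega))

/-- The total cost of the recursive calls that an annotation allows for a problem of size `u`, if a
call of size `s` costs at most `T s`. -/
def recCost (T : ℕ → ℕ) (l : List (ℕ × (ℕ → ℤ))) (u : ℕ) : ℕ :=
  (l.map fun p => p.1 * runMax T (p.2 u)).sum

@[simp] theorem recCost_nil (T : ℕ → ℕ) (u : ℕ) : recCost T [] u = 0 := rfl

@[simp] theorem recCost_cons (T : ℕ → ℕ) (p : ℕ × (ℕ → ℤ)) (l : List (ℕ × (ℕ → ℤ))) (u : ℕ) :
    recCost T (p :: l) u = p.1 * runMax T (p.2 u) + recCost T l u := by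
  simp [recCost]

@[simp] theorem recCost_append (T : ℕ → ℕ) (l l' : List (ℕ × (ℕ → ℤ))) (u : ℕ) :
    recCost T (l ++ l') u = recCost T l u + recCost T l' u := by
  simp [recCost]

theorem CostShare.recCost_add_le {l l₁ l₂ : List (ℕ × (ℕ → ℤ))} (h : CostShare l l₁ l₂)
    (T : ℕ → ℕ) (u : ℕ) : recCost T l₁ u + recCost T l₂ u ≤ recCost T l u := by
  induction h with
  | nil => simp
  | cons c c₁ c₂ φ l l₁ l₂ hc htail ih =>
    simp only [recCost_cons]
    have := Nat.mul_le_mul_right (runMax T (φ u)) hc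
    rw [add_mul] at this
    omega

theorem Ann.ShareMany.sum_recCost_le {α : Ann} {αs : List Ann} (h : α.ShareMany αs)
    (T : ℕ → ℕ) (u : ℕ) :
    (αs.map fun α' => recCost T α'.costs u).sum ≤ recCost T α.costs u := by
  induction h with
  | nil => simp
  | refl => simp
  | cons α α₁ α' αs hshare htail ih =>
    have := hshare.2.2.recCost_add_le T u
    simp only [List.map_cons, List.sum_cons]
    omega

theorem Ann.ShareMany.bound_eq {α : Ann} {αs : List Ann} (h : α.ShareMany αs) :
    ∀ α' ∈ αs, α'.bound = α.bound := by
  induction h with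
  | nil => simp
  | refl => simp
  | cons α α₁ α' αs hshare htail ih =>
    simp only [List.mem_cons, forall_eq_or_imp]
    exact ⟨hshare.1, fun β hβ => (ih β hβ).trans hshare.2.1⟩

theorem Ann.Sub.recCost_le {𝒟 : DataSig} {size : SizeFun} {Γ : Env} {α α' : Ann}
    (h : Ann.Sub 𝒟 size Γ α α') (T : ℕ → ℕ) {ρ : Store} (hρ : Γ.Sat 𝒟 ρ) :
    recCost T α.costs (Γ.topSize size ρ) ≤ recCost T α'.costs (Γ.topSize size ρ) := by
  cases h with
  | mono l l' ψ ψ' hcost hbound =>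
    dsimp only
    clear hbound
    induction hcost with
    | nil => simp
    | cons hp _ ih =>
      simp only [recCost_cons]
      exact add_le_add (Nat.mul_le_mul hp.1 (runMax_mono T (hp.2 ρ hρ))) ih
  | split c₁ c₂ φ₁ φ₂ l ψ hφ =>
    simp only [recCost_cons, hφ ρ hρ, add_mul, add_assoc, le_refl]
  | combine c₁ c₂ φ₁ φ₂ l ψ hφ =>
    simp only [recCost_cons, hφ ρ hρ, add_mul, add_assoc, le_refl]
  | add => simp
  | perm l l' ψ hperm => exact (hperm.map _).sum_eq.le

theorem Ann.Sub.bound_sub {𝒟 : DataSig} {size : SizeFun} {Γ : Env} {α α' : Ann}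
    (h : Ann.Sub 𝒟 size Γ α α') {ρ : Store} (hρ : Γ.Sat 𝒟 ρ) :
    BigO α.bound.eval α'.bound.eval := by
  have hrefl : ∀ ψ : Bound, BigO ψ.eval ψ.eval := fun ψ => ⟨0, 1, by simp, by simp⟩
  cases h with
  | mono l l' ψ ψ' hcost hbound => exact hbound ρ hρ
  | split => exact hrefl _
  | combine => exact hrefl _
  | add => exact hrefl _
  | perm => exact hrefl _

/-! ### Cost soundness -/

/-- The implementations of the auxiliary functions of `Γ` meet their bounds, uniformly in the
valuations that agree with `ρ₀` on `V`. -/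
def Env.MeetsBounds (𝒟 : DataSig) (size : SizeFun) (Γ : Env) (V : Set Var) (ρ₀ : Store)
    (θ : Var → Tm) : Prop :=
  ∀ g n (F : FunTy n) ψ, Entry.fn g n F ψ ∈ Γ.entries → Γ.recFun ≠ some g → ∃ L : ℕ,
    ∀ ρ, Set.EqOn ρ₀ ρ V → ∀ ws, F.Inputs 𝒟 ρ ws → ∀ k v C,
      Run k (.app (θ g) n fun i => .const (ws i)) v C → (C : ℝ) ≤ L * (ψ.eval (size g n ws) + 1)

/-- The calls of the recursive function of `Γ` cost at most `T` of their size. -/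
def Env.MeetsRec (𝒟 : DataSig) (size : SizeFun) (Γ : Env) (V : Set Var) (ρ₀ : Store)
    (θ : Var → Tm) (T : ℕ → ℕ) : Prop :=
  ∀ g n (F : FunTy n) ψ, Entry.fn g n F ψ ∈ Γ.entries → Γ.recFun = some g →
    ∀ ρ, Set.EqOn ρ₀ ρ V → ∀ ws, F.Inputs 𝒟 ρ ws → ∀ k v C,
      Run k (.app (θ g) n fun i => .const (ws i)) v C → C ≤ T (size g n ws)

/-- For all sufficiently large problem sizes `u`, the evaluation of `t` costs at most what `α`
allows for recursive calls plus a fixed multiple of `ψ u + 1`, where `ψ` is the bound of `α`.  The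
single constant `L` serves as the threshold and as the factor. -/
def CostBounded (𝒟 : DataSig) (size : SizeFun) (Γ : Env) (V : Set Var) (ρ₀ : Store)
    (θ : Var → Tm) (T : ℕ → ℕ) (t : Tm) (α : Ann) (L : ℕ) : Prop :=
  ∀ ρ, Set.EqOn ρ₀ ρ V → Γ.StrongSat 𝒟 ρ → L ≤ Γ.topSize size ρ → ∀ k v C,
    Run k (t.close ρ θ) v C →
      (C : ℝ) ≤ recCost T α.costs (Γ.topSize size ρ) +
        L * (α.bound.eval (Γ.topSize size ρ) + 1)

section

variable {𝒟 : DataSig} {size : SizeFun} {Γ : Env} {V : Set Var} {ρ₀ ρ : Store} {θ : Var → Tm}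
  {T : ℕ → ℕ}

theorem FunNameTy.cost_le {g : Var} {n : ℕ} {F : FunTy n} {ψ : Bound}
    (h : FunNameTy 𝒟 Γ g n F ψ) (hb : Γ.MeetsBounds 𝒟 size V ρ₀ θ) (hg : Γ.recFun ≠ some g) :
    ∃ L : ℕ, ∀ ρ, Set.EqOn ρ₀ ρ V → Γ.Sat 𝒟 ρ → ∀ ws, F.Inputs 𝒟 ρ ws → ∀ k v C,
      Run k (.app (θ g) n fun i => .const (ws i)) v C →
        (C : ℝ) ≤ L * (ψ.eval (size g n ws) + 1) := by
  induction h with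
  | var F ψ hmem =>
    obtain ⟨L, hL⟩ := hb g n F ψ hmem hg
    exact ⟨L, fun ρ hρ _ => hL ρ hρ⟩
  | sub F F' ψ ψ' hty hF hψ ih =>
    obtain ⟨L, hL⟩ := ih
    -- Without an instance of `Γ`, the subtyping of bounds says nothing, and there is nothing to show.
    by_cases hs : ∃ ρ, Γ.Sat 𝒟 ρ
    · obtain ⟨ρ', hρ'⟩ := hs
      obtain ⟨L', hL'⟩ := (hψ ρ' hρ').exists_le
      refine ⟨L * (L' + 1), fun ρ hρ hsat ws hws k v C hr => ?_⟩
      have h₁ := hL ρ hρ hsat ws (hF.2.2 ρ hsat ws hws).1 k v C hr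
      have h₂ := mul_le_mul_of_nonneg_left (hL' (size g n ws)) (L.cast_nonneg (α := ℝ))
      have h₃ := mul_nonneg (L.cast_nonneg (α := ℝ)) (ψ'.eval_nonneg (size g n ws))
      push_cast
      linarith
    · exact ⟨0, fun ρ _ hsat => absurd ⟨ρ, hsat⟩ hs⟩

theorem FunNameTy.recCall_cost_le {g : Var} {n : ℕ} {F : FunTy n} {ψ : Bound}
    (h : FunNameTy 𝒟 Γ g n F ψ) (hb : Γ.MeetsRec 𝒟 size V ρ₀ θ T) (hg : Γ.recFun = some g)
    (hρ : Set.EqOn ρ₀ ρ V) (hsat : Γ.Sat 𝒟 ρ) {ws : Fin n → Val} (hws : F.Inputs 𝒟 ρ ws)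
    {k : ℕ} {v : Val} {C : ℕ} (hr : Run k (.app (θ g) n fun i => .const (ws i)) v C) :
    C ≤ T (size g n ws) := by
  induction h with
  | var F ψ hmem => exact hb g n F ψ hmem hg ρ hρ ws hws k v C hr
  | sub F F' ψ ψ' hty hF hψ ih => exact ih (hF.2.2 ρ hsat ws hws).1

/-- The costs of the arguments of an application add up to what the shared annotation allows. -/
theorem CostBounded.sum_args_le {m : ℕ} {es : Fin m → Tm} {αs : Fin m → Ann} {α : Ann}
    {Ls : Fin m → ℕ} (hshare : α.ShareMany (List.ofFn αs))
    (h : ∀ i, CostBounded 𝒟 size Γ V ρ₀ θ T (es i) (αs i) (Ls i)) (hρ : Set.EqOn ρ₀ ρ V)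
    (hsat : Γ.StrongSat 𝒟 ρ) (hL : ∑ i, Ls i ≤ Γ.topSize size ρ) {k : ℕ} {ws : Fin m → Val}
    {Cs : Fin m → ℕ} (ha : RunArgs k (fun i => (es i).close ρ θ) ws Cs) :
    ((∑ i, Cs i : ℕ) : ℝ) ≤ recCost T α.costs (Γ.topSize size ρ) +
      (∑ i, Ls i : ℕ) * (α.bound.eval (Γ.topSize size ρ) + 1) := by
  have hsum := hshare.sum_recCost_le T (Γ.topSize size ρ)
  rw [List.map_ofFn, List.sum_ofFn] at hsum
  calc ((∑ i, Cs i : ℕ) : ℝ)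
      = ∑ i, (Cs i : ℝ) := by push_cast; rfl
    _ ≤ ∑ i, ((recCost T (αs i).costs (Γ.topSize size ρ) : ℝ) +
          Ls i * (α.bound.eval (Γ.topSize size ρ) + 1)) := by
        refine Finset.sum_le_sum fun i _ => ?_
        obtain ⟨k', -, hr⟩ := ha i
        have := h i ρ hρ hsat
          ((Finset.single_le_sum (fun _ _ => Nat.zero_le _) (Finset.mem_univ i)).trans hL)
          k' _ _ hr
        rwa [hshare.bound_eq (αs i) (List.mem_ofFn.2 ⟨i, rfl⟩)] at this
    _ = ((∑ i, recCost T (αs i).costs (Γ.topSize size ρ) : ℕ) : ℝ) +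
          (∑ i, Ls i : ℕ) * (α.bound.eval (Γ.topSize size ρ) + 1) := by
        rw [Finset.sum_add_distrib, ← Finset.sum_mul]
        push_cast
        rfl
    _ ≤ _ := by
        gcongr
        exact hsum

theorem ETermTy.costBounded {e : Tm} {τ : RTy} {α : Ann} (h : ETermTy 𝒟 size Γ e τ α)
    (hθ : ∀ N, Γ.MeetsTypes 𝒟 N V ρ₀ θ) (hb : Γ.MeetsBounds 𝒟 size V ρ₀ θ)
    (hrec : Γ.MeetsRec 𝒟 size V ρ₀ θ T) :
    ∃ L, CostBounded 𝒟 size Γ V ρ₀ θ T e α L := by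
  induction h with
  | sub e τ τ' α α' hty hτ hα ih =>
    obtain ⟨L, hL⟩ := ih
    by_cases hs : ∃ ρ, Γ.Sat 𝒟 ρ
    · obtain ⟨ρ', hρ'⟩ := hs
      obtain ⟨L', hL'⟩ := (hα.bound_sub hρ').exists_le
      refine ⟨L * (L' + 1), fun ρ hρ hsat hu k v C hr => ?_⟩
      have h₁ := hL ρ hρ hsat (le_trans (Nat.le_mul_of_pos_right _ (by omega)) hu) k v C hr
      have h₂ := mul_le_mul_of_nonneg_left (hL' (Γ.topSize size ρ)) (L.cast_nonneg (α := ℝ))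
      have h₃ := mul_nonneg (L.cast_nonneg (α := ℝ)) (α'.bound.eval_nonneg (Γ.topSize size ρ))
      have h₄ : (recCost T α.costs (Γ.topSize size ρ) : ℝ) ≤
        recCost T α'.costs (Γ.topSize size ρ) := by exact_mod_cast hα.recCost_le T hsat.sat
      push_cast
      linarith
    · exact ⟨0, fun ρ _ hsat => absurd ⟨ρ, hsat.sat⟩ hs⟩
  | var x τ α hmem =>
    refine ⟨0, fun ρ hρ hsat hu k v C hr => ?_⟩
    simp only [Tm.close, Tm.subst, Option.elim] at hr
    obtain ⟨-, rfl⟩ := hr.const_inv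
    simp
  | const w B hv =>
    refine ⟨0, fun ρ hρ hsat hu k v C hr => ?_⟩
    simp only [Tm.close, Tm.subst] at hr
    obtain ⟨-, rfl⟩ := hr.const_inv
    simp
  | con K es τs αs α hshare hes harg ih =>
    choose Ls hLs using ih
    refine ⟨∑ i, Ls i, fun ρ hρ hsat hu k v C hr => ?_⟩
    simp only [Tm.close, Tm.subst] at hr
    obtain ⟨ws, Cs, ha, -, rfl⟩ := hr.con_inv
    exact CostBounded.sum_args_le hshare hLs hρ hsat hu ha
  | app g m F ψg es τs αs α hg hne hshare hes harg hcost ih =>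
    choose Ls hLs using ih
    obtain ⟨c, M, hM, hcost⟩ := hcost
    obtain ⟨M', hM'⟩ := exists_nat_ge M
    obtain ⟨Lg, hLg⟩ := hg.cost_le hb hne
    refine ⟨∑ i, Ls i + (Lg * (M' + 1) + c), fun ρ hρ hsat hu k v C hr => ?_⟩
    obtain ⟨ws, Cs, k', C', ha, hk', hr', rfl⟩ := hr.app_close_inv (hg.meets (hθ k) hρ hsat.sat)
    have hws : ∀ i, (τs i).Mem 𝒟 ρ (ws i) := fun i =>
      let ⟨k', hk', hr'⟩ := ha i; (hes i).sound (hθ k) hρ hsat.sat k' hk' _ _ hr'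
    have h₁ := CostBounded.sum_args_le hshare hLs hρ hsat (by omega) ha
    have h₂ := hLg ρ hρ hsat.sat ws (harg.2 ρ hsat.sat ws hws) k' v C' hr'
    have h₃ := hcost ρ hsat.sat ws hws (by omega)
    have h₀ := α.bound.eval_nonneg (Γ.topSize size ρ)
    have h₄ := h₃.trans (mul_le_mul_of_nonneg_right hM' h₀)
    have h₅ := mul_le_mul_of_nonneg_left h₄ (Lg.cast_nonneg (α := ℝ))
    have h₆ := mul_nonneg (Lg.cast_nonneg (α := ℝ)) h₀
    have h₇ := mul_nonneg (c.cast_nonneg (α := ℝ)) h₀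
    have h₈ : (0 : ℝ) ≤ Lg * M' := by positivity
    have h₉ := c.cast_nonneg (α := ℝ)
    push_cast at h₁ ⊢
    linarith
  | recApp f m F ψf es τs αs l₁ l₂ c φ ψ hf hfrec hshare hes harg hsize ih =>
    choose Ls hLs using ih
    refine ⟨∑ i, Ls i, fun ρ hρ hsat hu k v C hr => ?_⟩
    obtain ⟨ws, Cs, k', C', ha, hk', hr', rfl⟩ := hr.app_close_inv (hf.meets (hθ k) hρ hsat.sat)
    have hws : ∀ i, (τs i).Mem 𝒟 ρ (ws i) := fun i =>
      let ⟨k', hk', hr'⟩ := ha i; (hes i).sound (hθ k) hρ hsat.sat k' hk' _ _ hr'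
    have h₁ := CostBounded.sum_args_le hshare hLs hρ hsat (by omega) ha
    have h₂ : C' ≤ runMax T (φ (Γ.topSize size ρ)) :=
      (hf.recCall_cost_le hrec hfrec hρ hsat.sat (harg.2 ρ hsat.sat ws hws) hr').trans
        (le_runMax T (hsize ρ hsat.sat ws hws))
    have h₃ : (C' : ℝ) ≤ runMax T (φ (Γ.topSize size ρ)) := by exact_mod_cast h₂
    simp only [recCost_append, recCost_cons] at h₁ ⊢
    push_cast at h₁ ⊢
    linarith

theorem Env.topSize_eq_of_eqOn {size : SizeFun} {Γ Γ' : Env} (hr : Γ'.recFun = Γ.recFun)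
    (ha : Γ'.args = Γ.args) (hargs : ∀ i, Γ.args.2 i ∈ Γ.vars) {ρ ρ' : Store}
    (h : Set.EqOn ρ ρ' Γ.vars) : Γ'.topSize size ρ' = Γ.topSize size ρ := by
  unfold Env.topSize
  rw [hr, ha]
  cases Γ.recFun with
  | none => rfl
  | some f =>
    dsimp only
    congr 1
    exact funext fun i => (h (hargs i)).symm

theorem TermTy.costBounded {t : Tm} {τ : RTy} {α : Ann} (h : TermTy 𝒟 size Γ t τ α)
    (hcl : ∀ g, (θ g).Closed) (hV : V ⊆ Γ.vars) (hargs : ∀ i, Γ.args.2 i ∈ Γ.vars)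
    (hθ : ∀ N, Γ.MeetsTypes 𝒟 N V ρ₀ θ) (hb : Γ.MeetsBounds 𝒟 size V ρ₀ θ)
    (hrec : Γ.MeetsRec 𝒟 size V ρ₀ θ T) :
    ∃ L, CostBounded 𝒟 size Γ V ρ₀ θ T t α L := by
  induction h with
  | eterm Γ e τ α hty => exact hty.costBounded hθ hb hrec
  | ite Γ e t₁ t₂ φ τ α α₁ α₂ hshare he h₁ h₂ ih₁ ih₂ =>
    have hθ' : ∀ p N, (Γ.assume p).MeetsTypes 𝒟 N V ρ₀ θ := fun p N g n F ψ hg =>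
      hθ N g n F ψ (Env.fn_mem_assume.1 hg)
    have hb' : ∀ p, (Γ.assume p).MeetsBounds 𝒟 size V ρ₀ θ := fun p g n F ψ hg =>
      hb g n F ψ (Env.fn_mem_assume.1 hg)
    have hrec' : ∀ p, (Γ.assume p).MeetsRec 𝒟 size V ρ₀ θ T := fun p g n F ψ hg =>
      hrec g n F ψ (Env.fn_mem_assume.1 hg)
    obtain ⟨L, hL⟩ := he.costBounded hθ hb hrec
    obtain ⟨L₁, hL₁⟩ := ih₁ (by simpa using hV) (by rw [Env.vars_assume]; exact hargs)
      (hθ' _) (hb' _) (hrec' _)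
    obtain ⟨L₂, hL₂⟩ := ih₂ (by simpa using hV) (by rw [Env.vars_assume]; exact hargs)
      (hθ' _) (hb' _) (hrec' _)
    refine ⟨L + (L₁ + L₂), fun ρ hρ hsat hu k v C hr => ?_⟩
    obtain ⟨b, k₁, k₂, C₁, C₂, hk₁, hk₂, hr₁, hr₂, rfl⟩ := hr.ite_close_inv
    have hs := he.assume_strongSat hV (hθ k) hρ hsat hk₁ hr₁
    have hc₁ := hL ρ hρ hsat (by omega) _ _ _ hr₁
    have hψ := α.bound.eval_nonneg (Γ.topSize size ρ)
    rw [hshare.1] at hc₁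
    have hsum : (recCost T α₁.costs (Γ.topSize size ρ) : ℝ) +
        recCost T α₂.costs (Γ.topSize size ρ) ≤ recCost T α.costs (Γ.topSize size ρ) := by
      exact_mod_cast hshare.2.2.recCost_add_le T _
    have h₀ := mul_nonneg (L₁.cast_nonneg (α := ℝ)) hψ
    have h₀' := mul_nonneg (L₂.cast_nonneg (α := ℝ)) hψ
    have hp₁ := L₁.cast_nonneg (α := ℝ)
    have hp₂ := L₂.cast_nonneg (α := ℝ)
    have htop : ∀ p, (Γ.assume p).topSize size ρ = Γ.topSize size ρ := fun p =>
      Env.topSize_eq_of_eqOn rfl rfl hargs (Set.eqOn_refl _ _)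
    push_cast
    cases b
    · have hc₂ := hL₂ ρ hρ hs (by rw [htop]; omega) _ _ _ hr₂
      rw [htop, hshare.2.1] at hc₂
      linarith
    · have hc₂ := hL₁ ρ hρ hs (by rw [htop]; omega) _ _ _ hr₂
      rw [htop, hshare.2.1] at hc₂
      linarith
  | mtch Γ e m K xs t D τs τ α α₁ α₂ hshare he hD hres hinj hfresh ht ih =>
    obtain ⟨L, hL⟩ := he.costBounded hθ hb hrec
    have ih' := fun i => ih i (by rw [Env.vars_branch]; exact hV.trans Set.subset_union_left)
      (by rw [Env.vars_branch]; exact fun j => .inl (hargs j))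
      (fun N g n F ψ hg => hθ N g n F ψ (Env.fn_mem_branch.1 hg))
      (fun g n F ψ hg => hb g n F ψ (Env.fn_mem_branch.1 hg))
      (fun g n F ψ hg => hrec g n F ψ (Env.fn_mem_branch.1 hg))
    choose Ls hLs using ih'
    refine ⟨L + ∑ i, Ls i, fun ρ hρ hsat hu k v C hr => ?_⟩
    obtain ⟨i, ws, k₁, k₂, C₁, C₂, hk₁, hk₂, hr₁, hr₂, rfl⟩ := hr.mtch_close_inv hcl
    have hs := he.branch_strongSat hD (hinj i) (hfresh i) hV (hθ k) hρ hsat hk₁ hr₁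
    have hext := eqOn_extend (xs i) ws ρ (hfresh i)
    have htop : (Γ.branch 𝒟 τs (K i) (xs i)).topSize size (Function.extend (xs i) ws ρ) =
        Γ.topSize size ρ := Env.topSize_eq_of_eqOn rfl rfl hargs hext
    have hi : Ls i ≤ ∑ i, Ls i :=
      Finset.single_le_sum (fun _ _ => Nat.zero_le _) (Finset.mem_univ i)
    have hc₁ := hL ρ hρ hsat (by omega) _ _ _ hr₁
    have hc₂ := hLs i _ (hρ.trans (hext.mono hV)) hs (by rw [htop]; omega) _ _ _ hr₂
    rw [htop, hshare.2.1] at hc₂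
    rw [hshare.1] at hc₁
    have hψ := α.bound.eval_nonneg (Γ.topSize size ρ)
    have hsum : (recCost T α₁.costs (Γ.topSize size ρ) : ℝ) +
        recCost T α₂.costs (Γ.topSize size ρ) ≤ recCost T α.costs (Γ.topSize size ρ) := by
      exact_mod_cast hshare.2.2.recCost_add_le T _
    have hi' : (Ls i : ℝ) ≤ (∑ i, Ls i : ℕ) := by exact_mod_cast hi
    have hm := mul_le_mul_of_nonneg_right hi'
      (by linarith : 0 ≤ α.bound.eval (Γ.topSize size ρ) + 1)
    rw [Nat.cast_add, Nat.cast_add, add_mul]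
    linarith

end

/-! ### Recurrences -/

/-- The substitution method: a monotone function `G` that satisfies the recurrence of `T` from `N`
on, and dominates the values of `T` up to `N`, dominates `T`. -/
theorem le_of_recurrence {T : ℕ → ℕ} {G : ℕ → ℝ} {N : ℕ}
    (hG : ∀ v, 0 ≤ G v) (hmono : ∀ v w, 1 ≤ v → v ≤ w → G v ≤ G w)
    (hN : 1 ≤ N) (hbase : ∀ v, 1 ≤ v → (runMax T N : ℝ) ≤ G v)
    (hstep : ∀ u, N ≤ u → (∀ v : ℕ, 1 ≤ v → v < u → (runMax T v : ℝ) ≤ G v) → (T u : ℝ) ≤ G u)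
    (u : ℕ) (hu : 1 ≤ u) : (T u : ℝ) ≤ G u := by
  suffices ∀ v : ℕ, 1 ≤ v → (runMax T v : ℝ) ≤ G v from
    (Nat.cast_le.2 (le_runMax T le_rfl)).trans (this u hu)
  intro v hv
  induction v using Nat.strong_induction_on with
  | _ v ih =>
    refine runMax_le T (hG v) fun s hs => ?_
    by_cases hsN : N ≤ s
    · exact (hstep s hsN fun w hw hws => ih w (by omega) hw).trans
        (hmono s v (by omega) (by omega))
    · have : T s ≤ runMax T N := le_runMax T (by omega)
      exact (Nat.cast_le.2 this).trans (hbase v hv)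

theorem natCast_log_mono {v w : ℕ} (hv : 1 ≤ v) (h : v ≤ w) :
    Real.log v ≤ Real.log w :=
  Real.log_le_log (by exact_mod_cast hv) (by exact_mod_cast h)

theorem one_le_log_natCast {u : ℕ} (hu : 3 ≤ u) : 1 ≤ Real.log u := by
  have h : (3 : ℝ) ≤ u := by exact_mod_cast hu
  rw [Real.le_log_iff_exp_le (by linarith)]
  linarith [Real.exp_one_lt_three]

theorem bigO_log_of_recurrence {T : ℕ → ℕ} {N d : ℕ} {K : ℝ} (hd : 2 ≤ d) (hK : 0 ≤ K)
    (h : ∀ u, N ≤ u → (T u : ℝ) ≤ runMax T (u / d : ℕ) + K) :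
    BigO (fun u => T u) fun u => Real.log u := by
  have hlog2 : 0 < Real.log 2 := Real.log_pos (by norm_num)
  set B : ℝ := (runMax T (N + d : ℕ) : ℝ)
  have hB : 0 ≤ B := Nat.cast_nonneg _
  have hK' : 0 ≤ K / Real.log 2 := by positivity
  have key : ∀ u, 1 ≤ u → (T u : ℝ) ≤ B + K / Real.log 2 * Real.log u := by
    refine le_of_recurrence (N := N + d) (fun v => ?_) (fun v w hv hvw => ?_) (by omega)
      (fun v hv => ?_) fun u hu ih => ?_
    · have := Real.log_natCast_nonneg v
      positivity
    · have := natCast_log_mono hv hvw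
      gcongr
    · have := mul_nonneg hK' (Real.log_natCast_nonneg v)
      linarith
    · have hpos : 1 ≤ u / d := (Nat.one_le_div_iff (by omega)).2 (by omega)
      have h₁ := h u (by omega)
      have h₂ := ih (u / d) hpos (Nat.div_lt_self (by omega) (by omega))
      have h₃ : Real.log (u / d : ℕ) + Real.log 2 ≤ Real.log u := by
        have hp : (0 : ℝ) < (u / d : ℕ) := by exact_mod_cast hpos
        rw [← Real.log_mul hp.ne' (by norm_num)]
        refine Real.log_le_log (by positivity) ?_
        have : u / d * 2 ≤ u := (Nat.mul_le_mul_left _ hd).trans (Nat.div_mul_le_self u d)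
        exact_mod_cast this
      have h₄ := mul_le_mul_of_nonneg_left h₃ hK'
      rw [mul_add, div_mul_cancel₀ _ hlog2.ne'] at h₄
      linarith
  refine ⟨3, B + K / Real.log 2, by positivity, fun u hu => (key u (by omega)).trans ?_⟩
  have := mul_le_mul_of_nonneg_left (one_le_log_natCast hu) hB
  linarith

/-- A divide-and-conquer recurrence with linear overhead, for subproblems that are of sizes at most
`3 / 4 * u` and of total size at most `u`: on every level, the potential `v * log v` drops by
`log (4 / 3)` per unit of size, which pays for the overhead. -/
theorem bigO_linLog_of_recurrence {T : ℕ → ℕ} {N : ℕ} {K : ℝ} (hK : 0 ≤ K) (l : ℕ → List ℕ)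
    (hsum : ∀ u, N ≤ u → (l u).sum ≤ u)
    (hl : ∀ u, N ≤ u → ∀ v ∈ l u, 1 ≤ v ∧ 4 * v ≤ 3 * u)
    (h : ∀ u, N ≤ u → (T u : ℝ) ≤ ((l u).map fun v : ℕ => (runMax T v : ℝ)).sum + K * u) :
    BigO (fun u => T u) fun u => u * Real.log u := by
  set δ := Real.log (4 / 3) with hδ
  have hδ0 : 0 < δ := Real.log_pos (by norm_num)
  set B : ℝ := (runMax T (N + 2 : ℕ) : ℝ)
  have hB : 0 ≤ B := Nat.cast_nonneg _
  have hK' : 0 ≤ K / δ := by positivity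
  have key : ∀ u, 1 ≤ u → (T u : ℝ) ≤ K / δ * (u * Real.log u) + B * u := by
    refine le_of_recurrence (N := N + 2) (fun v => ?_) (fun v w hv hvw => ?_) (by omega)
      (fun v hv => ?_) fun u hu ih => ?_
    · have := Real.log_natCast_nonneg v
      positivity
    · have := natCast_log_mono hv hvw
      have := Real.log_natCast_nonneg v
      have : (v : ℝ) ≤ w := by exact_mod_cast hvw
      gcongr
    · have hv' : (1 : ℝ) ≤ v := by exact_mod_cast hv
      have := Real.log_natCast_nonneg v
      have h₁ : 0 ≤ K / δ * (v * Real.log v) := by positivity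
      have := le_mul_of_one_le_right hB hv'
      linarith
    · have hu0 : (0 : ℝ) < u := by exact_mod_cast (by omega : 0 < u)
      set X : ℝ := K / δ * (Real.log u - δ) + B with hX
      have hX0 : 0 ≤ X := by
        have : δ ≤ Real.log u := Real.log_le_log (by norm_num) (by
          have : (2 : ℝ) ≤ u := by exact_mod_cast (by omega : 2 ≤ u)
          linarith)
        have := mul_nonneg hK' (sub_nonneg.2 this)
        linarith
      have hterm : ∀ v ∈ l u, (runMax T v : ℝ) ≤ v * X := fun v hv => by
        obtain ⟨h₁, h₂⟩ := hl u (by omega) v hv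
        have hv0 : (0 : ℝ) < v := by exact_mod_cast h₁
        have h₃ : Real.log v + δ ≤ Real.log u := by
          rw [hδ, ← Real.log_mul hv0.ne' (by norm_num)]
          refine Real.log_le_log (by positivity) ?_
          have : (4 : ℝ) * v ≤ 3 * u := by exact_mod_cast h₂
          linarith
        calc (runMax T v : ℝ) ≤ K / δ * (v * Real.log v) + B * v := ih v h₁ (by omega)
          _ = v * (K / δ * Real.log v + B) := by ring
          _ ≤ v * X := by rw [hX]; gcongr; linarith
      have hbound : ((l u).map fun v : ℕ => (runMax T v : ℝ)).sum ≤ u * X :=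
        calc ((l u).map fun v : ℕ => (runMax T v : ℝ)).sum
            ≤ ((l u).map fun v : ℕ => (v : ℝ) * X).sum := List.sum_le_sum hterm
          _ = ((l u).sum : ℕ) * X := by rw [List.sum_map_mul_right, Nat.cast_list_sum]
          _ ≤ u * X := by
            have : (((l u).sum : ℕ) : ℝ) ≤ u := by exact_mod_cast hsum u (by omega)
            gcongr
      have hKδ : K / δ * δ = K := div_mul_cancel₀ _ hδ0.ne'
      calc (T u : ℝ) ≤ u * X + K * u := (h u (by omega)).trans (by gcongr)
        _ = K / δ * (u * Real.log u) + B * u + (K - K / δ * δ) * u := by rw [hX]; ring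
        _ = _ := by rw [hKδ]; ring
  refine ⟨3, K / δ + B, by positivity, fun u hu => (key u (by omega)).trans ?_⟩
  have := mul_le_mul_of_nonneg_left (one_le_log_natCast hu) (mul_nonneg hB (Nat.cast_nonneg u))
  linarith

theorem bigO_lin_of_recurrence {T : ℕ → ℕ} {N d : ℕ} {K : ℝ} (hd : 1 ≤ d) (hK : 0 ≤ K)
    (h : ∀ u, N ≤ u → (T u : ℝ) ≤ runMax T ((u : ℤ) - d) + K) :
    BigO (fun u => T u) fun u => u := by
  set B : ℝ := (runMax T (N + 2 : ℕ) : ℝ)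
  have hB : 0 ≤ B := Nat.cast_nonneg _
  have key : ∀ u, 1 ≤ u → (T u : ℝ) ≤ B + K * u := by
    refine le_of_recurrence (N := N + 2) (fun v => by positivity) (fun v w hv hvw => by gcongr)
      (by omega) (fun v hv => ?_) fun u hu ih => ?_
    · have : 0 ≤ K * v := by positivity
      linarith
    · have h₁ := h u (by omega)
      have h₂ : (runMax T ((u : ℤ) - d) : ℝ) ≤ runMax T (u - 1 : ℕ) :=
        Nat.cast_le.2 (runMax_mono T (by omega))
      have h₃ := ih (u - 1) (by omega) (by omega)
      rw [Nat.cast_pred (R := ℝ) (by omega)] at h₃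
      linarith
  refine ⟨1, B + K, by positivity, fun u hu => (key u hu).trans ?_⟩
  have := le_mul_of_one_le_right hB (by exact_mod_cast hu : (1 : ℝ) ≤ u)
  linarith

theorem bigO_quad_of_recurrence {T : ℕ → ℕ} {N d : ℕ} {K : ℝ} (hd : 1 ≤ d) (hK : 0 ≤ K)
    (h : ∀ u, N ≤ u → (T u : ℝ) ≤ runMax T ((u : ℤ) - d) + K * u) :
    BigO (fun u => T u) fun u => (u : ℝ) ^ 2 := by
  set B : ℝ := (runMax T (N + 2 : ℕ) : ℝ)
  have hB : 0 ≤ B := Nat.cast_nonneg _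
  have key : ∀ u, 1 ≤ u → (T u : ℝ) ≤ B + K * (u : ℝ) ^ 2 := by
    refine le_of_recurrence (N := N + 2) (fun v => by positivity) (fun v w hv hvw => by gcongr)
      (by omega) (fun v hv => ?_) fun u hu ih => ?_
    · have : 0 ≤ K * (v : ℝ) ^ 2 := by positivity
      linarith
    · have h₁ := h u (by omega)
      have h₂ : (runMax T ((u : ℤ) - d) : ℝ) ≤ runMax T (u - 1 : ℕ) :=
        Nat.cast_le.2 (runMax_mono T (by omega))
      have h₃ := ih (u - 1) (by omega) (by omega)
      rw [Nat.cast_pred (R := ℝ) (by omega)] at h₃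
      have hu1 : (1 : ℝ) ≤ u := by exact_mod_cast (by omega : 1 ≤ u)
      have h₄ := mul_le_mul_of_nonneg_left (by nlinarith : ((u : ℝ) - 1) ^ 2 + u ≤ u ^ 2) hK
      linarith
  refine ⟨1, B + K, by positivity, fun u hu => (key u hu).trans ?_⟩
  have hu1 : (1 : ℝ) ≤ u := by exact_mod_cast hu
  have := le_mul_of_one_le_right hB (one_le_pow₀ hu1 : (1 : ℝ) ≤ u ^ 2)
  linarith

theorem floor_natCast_div (u d : ℕ) : ⌊(u : ℚ) / d⌋ = ((u / d : ℕ) : ℤ) := by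
  rw [← Int.natCast_floor_eq_floor (by positivity), Nat.floor_div_eq_div]

theorem ceil_natCast_half (u : ℕ) : ⌈(u : ℚ) / 2⌉ = (((u + 1) / 2 : ℕ) : ℤ) := by
  rw [Int.ceil_eq_iff]
  have h₁ : u ≤ 2 * ((u + 1) / 2) := by omega
  have h₂ : 2 * ((u + 1) / 2) < u + 2 := by omega
  have h₁' : (u : ℚ) ≤ 2 * ((u + 1) / 2 : ℕ) := by exact_mod_cast h₁
  have h₂' : (2 : ℚ) * ((u + 1) / 2 : ℕ) < u + 2 := by exact_mod_cast h₂
  constructor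
  · rw [Int.cast_natCast]; linarith
  · rw [Int.cast_natCast]; linarith

theorem Bound.eval_one (u : ℕ) : Bound.one.eval u = 1 := by simp [Bound.eval, Bound.one]

theorem Bound.eval_lin (u : ℕ) : Bound.lin.eval u = u := by simp [Bound.eval, Bound.lin]

theorem Bound.eval_quad : Bound.quad.eval = fun u : ℕ => (u : ℝ) ^ 2 := by
  funext u; simp [Bound.eval, Bound.quad]

theorem Bound.eval_logarithmic : Bound.logarithmic.eval = fun u : ℕ => Real.log u := by
  funext u; simp [Bound.eval, Bound.logarithmic]

theorem Bound.eval_linLog : Bound.linLog.eval = fun u : ℕ => u * Real.log u := by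
  funext u; simp [Bound.eval, Bound.linLog]

/-- The recurrence expressed by the annotation of a pattern has its solutions in the bound of the
pattern. -/
theorem Pattern.bigO {A : Ann} {ψ : Bound} (hp : Pattern A ψ) {T : ℕ → ℕ} {L : ℕ}
    (h : ∀ u, L ≤ u → (T u : ℝ) ≤ recCost T A.costs u + L * (A.bound.eval u + 1)) :
    BigO (fun u => T u) ψ.eval := by
  have hL : (0 : ℝ) ≤ 2 * L := by positivity
  -- The constant term of the overhead is absorbed by `u` as soon as `1 ≤ u`.
  have hlin : ∀ u, 1 ≤ u → (L : ℝ) * (Bound.lin.eval u + 1) ≤ 2 * L * u := fun u hu => by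
    have : (1 : ℝ) ≤ u := by exact_mod_cast hu
    have := le_mul_of_one_le_right (L.cast_nonneg (α := ℝ)) this
    rw [Bound.eval_lin]
    linarith
  cases hp with
  | masterLog d hd =>
    rw [Bound.eval_logarithmic]
    refine bigO_log_of_recurrence (N := L) (K := 2 * L) hd hL fun u hu => (h u hu).trans_eq ?_
    simp only [recCost_cons, recCost_nil, floor_natCast_div, Bound.eval_one]
    push_cast
    ring
  | masterLinLog d hd =>
    rw [Bound.eval_linLog]
    refine bigO_linLog_of_recurrence (N := L + d) (K := 2 * L) hL
      (fun u => List.replicate d (u / d)) (fun u hu => ?_) (fun u hu v hv => ?_) fun u hu => ?_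
    · rw [List.sum_replicate, smul_eq_mul]
      exact Nat.mul_div_le u d
    · obtain rfl := List.eq_of_mem_replicate hv
      have : u / d * 2 ≤ u := (Nat.mul_le_mul_left _ hd).trans (Nat.div_mul_le_self u d)
      exact ⟨(Nat.one_le_div_iff (by omega)).2 (by omega), by omega⟩
    · have h₁ := h u (by omega)
      have h₂ := hlin u (by omega)
      simp only [recCost_cons, recCost_nil, floor_natCast_div] at h₁
      rw [List.map_replicate, List.sum_replicate, nsmul_eq_mul]
      push_cast at h₁ ⊢
      linarith
  | akraBazzi =>
    rw [Bound.eval_linLog]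
    refine bigO_linLog_of_recurrence (N := L + 2) (K := 2 * L) hL
      (fun u => [(u + 1) / 2, u / 2]) (fun u hu => ?_) (fun u hu v hv => ?_) fun u hu => ?_
    · simp only [List.sum_cons, List.sum_nil]
      omega
    · simp only [List.mem_cons, List.not_mem_nil, or_false] at hv
      omega
    · have h₁ := h u (by omega)
      have h₂ := hlin u (by omega)
      have h₃ := floor_natCast_div u 2
      push_cast at h₃
      simp only [recCost_cons, recCost_nil, ceil_natCast_half, h₃] at h₁
      simp only [List.map_cons, List.map_nil, List.sum_cons, List.sum_nil]
      push_cast at h₁ ⊢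
      linarith
  | cFiniteLin d hd =>
    rw [show Bound.lin.eval = fun u : ℕ => (u : ℝ) from funext Bound.eval_lin]
    refine bigO_lin_of_recurrence (N := L) (K := 2 * L) hd hL fun u hu => (h u hu).trans_eq ?_
    simp only [recCost_cons, recCost_nil, Bound.eval_one]
    push_cast
    ring
  | cFiniteQuad d hd =>
    rw [Bound.eval_quad]
    refine bigO_quad_of_recurrence (N := L + 1) (K := 2 * L) hd hL fun u hu => ?_
    have h₁ := h u (by omega)
    have h₂ := hlin u (by omega)
    simp only [recCost_cons, recCost_nil] at h₁
    push_cast at h₁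
    linarith

/-! ### The recursive function -/

section

variable {𝒟 : DataSig} {size : SizeFun} {Γ : Env} {ρ : Store} {θ : Var → Tm}

theorem IsComplexity.cost_le {n : ℕ} {sz : (Fin n → Val) → ℕ} {F : FunTy n} {fn : Tm}
    {T : ℕ → ℕ} (h : IsComplexity 𝒟 sz F ρ fn T) {ws : Fin n → Val} (hws : F.Inputs 𝒟 ρ ws)
    {k : ℕ} {v : Val} {C : ℕ} (hr : Run k (.app fn n fun i => .const (ws i)) v C) :
    C ≤ T (sz ws) :=
  (h.2 (sz ws)).1 ⟨ws, hws, rfl, v, hr.evaluates⟩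

/-- A call of a closed recursive function takes one step more than its body. -/
theorem Run.close_fix_call_inv {f : Var} {n : ℕ} {F : FunTy n} {t : Tm} {ws : Fin n → Val}
    (hcl : ∀ g, (θ g).Closed) {k : ℕ} {v : Val} {C : ℕ}
    (hr : Run k (.app (Tm.close (.fix f n F.params t) ρ θ) n fun i => .const (ws i)) v C) :
    ∃ k' < k, Run k' (t.close (F.set ρ ws)
      (Function.update θ f (Tm.close (.fix f n F.params t) ρ θ))) v C := by
  obtain ⟨k', hk', hr'⟩ := Run.call_inv hr
  refine ⟨k', hk', ?_⟩
  rw [FunTy.set, ← Tm.subst_body _ _ _ _ _ _ hcl]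
  exact hr'

theorem closed_update (f : Var) {s : Tm} (hcl : ∀ g, (θ g).Closed) (hs : s.Closed) (g : Var) :
    (Function.update θ f s g).Closed := by
  by_cases h : g = f
  · subst h; rwa [Function.update_self]
  · rw [Function.update_of_ne h]; exact hcl g

theorem Env.fn_mem_enter {f : Var} {n : ℕ} {F : FunTy n} {B : Bound} {g : Var} {m : ℕ}
    {G : FunTy m} {ψ : Bound} (h : Entry.fn g m G ψ ∈ (Γ.enter f F B).entries) :
    Entry.fn g m G ψ = Entry.fn f n F B ∨ Entry.fn g m G ψ ∈ Γ.entries := by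
  simpa [Env.enter, List.mem_ofFn] using h

/-- The recursive function meets its type, by induction on the number of steps. -/
theorem Env.enter_meetsTypes (hΓ : Γ.Scoped) {f : Var} {n : ℕ} {t : Tm} {F : FunTy n} {A : Ann}
    {B : Bound} (hinj : Function.Injective F.params) (hfresh : ∀ i, F.params i ∉ Γ.vars)
    (hf : f ∉ Γ.funs) (hscope : F.Scoped Γ.vars)
    (ht : TermTy 𝒟 size (Γ.enter f F B) t F.cod A) (hinterp : Γ.Interp 𝒟 size ρ θ) (N : ℕ) :
    (Γ.enter f F B).MeetsTypes 𝒟 N Γ.vars ρ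
      (Function.update θ f (Tm.close (.fix f n F.params t) ρ θ)) := by
  obtain ⟨hsat, hcl, himp⟩ := hinterp
  have hsat' := hΓ.strongSat hsat
  induction N using Nat.strong_induction_on with
  | _ N ih =>
    intro g m G ψ hg ρ' hρ'
    obtain heq | hg := Env.fn_mem_enter hg
    · cases heq
      rw [Function.update_self]
      refine ⟨⟨_, _, _, rfl⟩, fun ws hws k hk v C hr => ?_⟩
      obtain ⟨k', hk', hr'⟩ := Run.close_fix_call_inv hcl hr
      rw [← hscope.inputs_iff hρ'] at hws
      rw [← hscope.cod_mem_iff hρ']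
      obtain ⟨ρ'', hρ'', hmem⟩ := ht.sound (closed_update f hcl (Tm.closed_close_fix _ _ _ _ _ hcl))
        (by rw [Env.vars_enter]; exact Set.subset_union_left) (ih k' (by omega))
        (eqOn_extend _ _ _ hfresh) (Env.enter_strongSat f hinj hfresh hscope hsat' hws) le_rfl hr'
      rw [Env.vars_enter] at hρ''
      exact ⟨hmem.1, (hscope.2 _ _ hρ'' v).2 hmem.2⟩
    · have hgf : g ≠ f := fun h => hf ⟨m, G, ψ, h ▸ hg⟩
      rw [Function.update_of_ne hgf]
      obtain ⟨hfix, hres, -⟩ := himp g m G ψ hg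
      have hG := hΓ.2.1 g m G ψ hg
      refine ⟨hfix, fun ws hws k hk v C hr => ?_⟩
      rw [← hG.inputs_iff hρ'] at hws
      rw [← hG.cod_mem_iff hρ']
      exact hres ws hws v C hr.evaluates

/-- The signatures of `Γ` are scoped, so their bounds, which hold at `ρ`, hold at every valuation that
agrees with `ρ` on the variables of `Γ`. -/
theorem Env.enter_meetsBounds (hΓ : Γ.Scoped) {f : Var} {n : ℕ} {F : FunTy n} {B : Bound}
    (hinterp : Γ.Interp 𝒟 size ρ θ) (s : Tm) :
    (Γ.enter f F B).MeetsBounds 𝒟 size Γ.vars ρ (Function.update θ f s) := by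
  intro g m G ψ hg hne
  have hgf : g ≠ f := fun h => hne (congrArg some h.symm)
  obtain heq | hg := Env.fn_mem_enter hg
  · cases heq; exact absurd rfl hgf
  · rw [Function.update_of_ne hgf]
    obtain ⟨-, -, T, hT, hO⟩ := hinterp.2.2 g m G ψ hg
    obtain ⟨L, hL⟩ := hO.exists_le
    refine ⟨L, fun ρ' hρ' ws hws k v C hr => ?_⟩
    rw [← (hΓ.2.1 g m G ψ hg).inputs_iff hρ'] at hws
    exact le_trans (by exact_mod_cast hT.cost_le hws hr) (hL _)

theorem Env.enter_meetsRec {f : Var} {n : ℕ} {F : FunTy n} {B : Bound} (hf : f ∉ Γ.funs)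
    (hscope : F.Scoped Γ.vars) {s : Tm} {T : ℕ → ℕ}
    (hT : IsComplexity 𝒟 (size f n) F ρ s T) :
    (Γ.enter f F B).MeetsRec 𝒟 size Γ.vars ρ (Function.update θ f s) T := by
  intro g m G ψ hg hgf ρ' hρ' ws hws k v C hr
  obtain rfl : f = g := Option.some_injective _ hgf
  obtain heq | hg := Env.fn_mem_enter hg
  · cases heq
    rw [Function.update_self] at hr
    rw [← hscope.inputs_iff hρ'] at hws
    exact hT.cost_le hws hr
  · exact absurd ⟨m, G, ψ, hg⟩ hf

end

end SynPlexity

theorem mainTheorem1 (𝒟 : DataSig) (size : SizeFun) (Γ : Env) (hΓ : Γ.Scoped)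
    (f : Var) (n : ℕ) (xs : Fin n → Var) (t : Tm) (F : FunTy n) (ψ : Bound)
    (hty : FunTermTy 𝒟 size Γ (.fix f n xs t) F ψ)
    (ρ : Store) (θ : Var → Tm) (hinterp : Γ.Interp 𝒟 size ρ θ)
    (T : ℕ → ℕ)
    (hT : IsComplexity 𝒟 (size f n) F ρ (Tm.close (.fix f n xs t) ρ θ) T) :
    BigO (fun u => T u) ψ.eval := by
  cases hty with
  | abs _ _ _ A _ hpat hinj hfresh hf hscope ht =>
    have hcl := hinterp.2.1
    have hV : Γ.vars ⊆ (Γ.enter f F ψ).vars := by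
      rw [Env.vars_enter]; exact Set.subset_union_left
    have hargs : ∀ i, (Γ.enter f F ψ).args.2 i ∈ (Γ.enter f F ψ).vars := fun i => by
      rw [Env.vars_enter]; exact .inr ⟨i, rfl⟩
    obtain ⟨L, hL⟩ := ht.costBounded (closed_update f hcl (Tm.closed_close_fix _ _ _ _ _ hcl))
      hV hargs (Env.enter_meetsTypes hΓ hinj hfresh hf hscope ht hinterp)
      (Env.enter_meetsBounds hΓ hinterp _) (Env.enter_meetsRec hf hscope hT)
    refine hpat.bigO (L := L) fun u hu => ?_
    have hψ := A.bound.eval_nonneg u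
    rw [← Nat.le_floor_iff (by positivity)]
    refine (hT.2 u).2 ?_
    rintro C ⟨ws, hws, rfl, v, hev⟩
    obtain ⟨k, hr⟩ := hev.run
    obtain ⟨k', -, hr'⟩ := Run.close_fix_call_inv hcl hr
    have htop : (Γ.enter f F ψ).topSize size (F.set ρ ws) = size f n ws := by
      change size f n (fun i => Function.extend F.params ws ρ (F.params i)) = _
      simp only [hinj.extend_apply]
    have := hL (F.set ρ ws) (eqOn_extend _ _ _ hfresh)
      (Env.enter_strongSat f hinj hfresh hscope (hΓ.strongSat hinterp.1) hws)
      (by rw [htop]; exact hu) k' v C hr'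
    rw [htop] at this
    exact Nat.le_floor this
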